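/- Let $T=\{t_z=\mathrm{diag}(z,\bar z): |z|=1\}\subset SU(2)$, $\mathbb{C}P^1=SU(2)/T$, and let $h=\begin{pmatrix}1&0\\0&-1\end{pmatrix}$, $X=\begin{pmatrix}0&1\\0&0\end{pmatrix}$, $Y=\begin{pmatrix}0&0\\1&0\end{pmatrix}$. Let $E,F$ be any orthonormal basis, for minus the Killing form of $\mathfrak{su}(2)$, of the orthogonal complement $\mathfrak t^\perp$ of $\mathfrak t=\mathrm{Lie}(T)$ such that $Z=\frac12(E-iF)$ is a root vector for the positive root, $[h,Z]=2Z$. On the Schwartz space $\mathcal S(\mathbb R)$ put $\sigma(E)=ix$, $\sigma(F)=\frac{d}{dx}$ and $H_0=\frac12(\sigma(E)^2+\sigma(F)^2)$. Let $h_l(x)=e^{x^2/2}\frac{d^l}{dx^l}e^{-x^2}$ be the Hermite functions (so $H_0h_l=-(l+\frac12)h_l$), and let $m(z)$, $|z|=1$, be the unitary operator of $L^2(\mathbb R)$ with $m(z)h_l=z^{2l+1}h_l$, $l\ge 0$ (the metaplectic representation composed with the lift of $\mathrm{Ad}:T\to U(\mathfrak t^\perp)$ to the double cover). Let $\Gamma(S)$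 be the space of smooth sections of the bundle of metaplectic spinors, that is, of smooth maps $f:SU(2)\to\mathcal S(\mathbb R)$ with $f(gt_z)=m(z)^{-1}f(g)$ for all $g\in SU(2)$, $|z|=1$. Write $A\cdot f$ for the derivative of $f$ along the left-invariant vector field of $A\in\mathfrak{su}(2)$, extended complex-linearly to $A\in\mathfrak{sl}(2,\mathbb C)$. Put $(Hf)(g)=H_0(f(g))$, $$Df=\sigma(E)(F\cdot f)-\sigma(F)(E\cdot f),\qquad \tilde Df=\sigma(E)(E\cdot f)+\sigma(F)(F\cdot f),$$ $$\mathscr D=D+i\tilde D,\qquad \bar{\mathscr D}=D-i\tilde D,\qquad P=i[\tilde D,D],$$ and let $\Omega=-\frac18h^2-\frac14(XY+YX)$ be the Casimir element (for minus the Killing form), acting as a second order left-invariant differential operator. Then $H$, $D$, $\tilde D$ and $\Omega$ map $\Gamma(S)$ to itself, and as operators on $\Gamma(S)$ $$P=-\Omega-\tfrac32H^2,\qquad [P,\mathscr D]=-3\mathscr DH-\tfrac32\mathscr D,\qquad [P,\bar{\mathscr D}]=3\bar{\mathscr D}H-\tfrac32\bar{\mathscr D}.$$ -/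

import Mathlib

open Complex Filter Topology MeasureTheory Matrix
open scoped SchwartzMap ContDiff

attribute [local instance 100] LieRing.ofAssociativeRing LieAlgebra.ofAssociativeAlgebra

noncomputable section

namespace CP1

/-! ### The group `SU(2)`, its Lie algebra, the exponential map and the maximal torus -/

/-- The compact group `SU(2)`. -/
abbrev SU2 : Type := Matrix.specialUnitaryGroup (Fin 2) ℂ

/-- The real Lie algebra `su(2)` of traceless skew-Hermitian matrices. -/
def su2 : LieSubalgebra ℝ (Matrix (Fin 2) (Fin 2) ℂ) where
  carrier := {A | Aᴴ = -A ∧ A.trace = 0}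
  zero_mem' := by simp
  add_mem' := by
    rintro A B ⟨hA, hA'⟩ ⟨hB, hB'⟩
    refine ⟨?_, by simp [Matrix.trace_add, hA', hB']⟩
    rw [Matrix.conjTranspose_add, hA, hB, neg_add]
  smul_mem' := by
    rintro c A ⟨hA, hA'⟩
    refine ⟨?_, by simp [Matrix.trace_smul, hA']⟩
    rw [Matrix.conjTranspose_smul, hA]
    simp
  lie_mem' := by
    rintro A B ⟨hA, _⟩ ⟨hB, _⟩
    refine ⟨?_, ?_⟩
    · simp only [LieRing.of_associative_ring_bracket, Matrix.conjTranspose_sub,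
        Matrix.conjTranspose_mul, hA, hB]
      noncomm_ring
    · simp only [LieRing.of_associative_ring_bracket, Matrix.trace_sub]
      rw [Matrix.trace_mul_comm A B, sub_self]

/-- The complexification `sl(2, ℂ)` of `su(2)`. -/
abbrev sl2 : LieSubalgebra ℂ (Matrix (Fin 2) (Fin 2) ℂ) := LieAlgebra.SpecialLinear.sl (Fin 2) ℂ

theorem exp_mem_SU2 (A : su2) :
    NormedSpace.exp (A : Matrix (Fin 2) (Fin 2) ℂ) ∈ Matrix.specialUnitaryGroup (Fin 2) ℂ := by
  obtain ⟨A, hA, htr⟩ := A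
  simp only
  have hinv : (NormedSpace.exp A) * (NormedSpace.exp (-A)) = 1 := by
    rw [← Matrix.exp_add_of_commute _ _ (Commute.neg_right (Commute.refl A)), add_neg_cancel,
      NormedSpace.exp_zero]
  rw [Matrix.mem_specialUnitaryGroup_iff]
  refine ⟨?_, ?_⟩
  · rw [Matrix.mem_unitaryGroup_iff, Matrix.star_eq_conjTranspose, ← Matrix.exp_conjTranspose, hA,
      hinv]
  · let J : Matrix (Fin 2) (Fin 2) ℂ := !![0, 1; -1, 0]
    have hJu : IsUnit J := by
      rw [Matrix.isUnit_iff_isUnit_det]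
      simp [J, Matrix.det_fin_two]
    have hJi : J⁻¹ = -J := by
      apply Matrix.inv_eq_right_inv
      ext i j
      fin_cases i <;> fin_cases j <;> simp [J, Matrix.mul_apply, Fin.sum_univ_two]
    have h11 : A 1 1 = -A 0 0 := by
      have h : A 0 0 + A 1 1 = 0 := by simpa [Matrix.trace, Fin.sum_univ_two] using htr
      linear_combination h
    have hT : Aᵀ = J * (-A) * J⁻¹ := by
      rw [hJi]
      ext i j
      fin_cases i <;> fin_cases j <;>
        simp [J, Matrix.mul_apply, Matrix.vecMul, dotProduct, Fin.sum_univ_two, h11]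
    have key : (NormedSpace.exp A)ᵀ = J * NormedSpace.exp (-A) * J⁻¹ := by
      rw [← Matrix.exp_transpose, hT, Matrix.exp_conj _ _ hJu]
    have key2 : (NormedSpace.exp A)ᵀ * J * NormedSpace.exp A = J := by
      have hJJ : J⁻¹ * J = 1 := Matrix.nonsing_inv_mul _ ((Matrix.isUnit_iff_isUnit_det _).1 hJu)
      have hinv' : (NormedSpace.exp (-A)) * (NormedSpace.exp A) = 1 := mul_eq_one_comm.1 hinv
      rw [key, mul_assoc (J * _), hJJ, mul_one, mul_assoc, hinv', mul_one]
    have e := congrFun (congrFun key2 0) 1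
    simp [J, Matrix.mul_apply, Fin.sum_univ_two] at e
    rw [Matrix.det_fin_two]
    linear_combination e

/-- The exponential map `su(2) → SU(2)`. -/
def expSU2 (A : su2) : SU2 := ⟨NormedSpace.exp (A : Matrix (Fin 2) (Fin 2) ℂ), exp_mem_SU2 A⟩

/-- The element `diag(z, z̄)` of the maximal torus `T = U(1)` of `SU(2)`. -/
def torus (z : Circle) : SU2 :=
  ⟨!![(z : ℂ), 0; 0, (starRingEnd ℂ) (z : ℂ)], by
    have hz : (z : ℂ) * (starRingEnd ℂ) (z : ℂ) = 1 := by
      rw [Complex.mul_conj, Circle.normSq_coe, Complex.ofReal_one]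
    rw [Matrix.mem_specialUnitaryGroup_iff, Matrix.mem_unitaryGroup_iff]
    refine ⟨?_, by simpa [Matrix.det_fin_two] using hz⟩
    ext i j
    fin_cases i <;> fin_cases j <;>
      simp [Matrix.star_eq_conjTranspose, Matrix.mul_apply, Fin.sum_univ_two, hz]
    rw [mul_comm, hz]⟩

/-- The coroot `h` of the positive root of `sl(2, ℂ)`. -/
def hElt : sl2 := ⟨!![1, 0; 0, -1], by
  change Matrix.trace (!![1, 0; 0, -1] : Matrix (Fin 2) (Fin 2) ℂ) = 0
  simp [Matrix.trace, Fin.sum_univ_two]⟩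

/-- The standard positive root vector `X` of `sl(2, ℂ)`. -/
def XElt : sl2 := ⟨!![0, 1; 0, 0], by
  change Matrix.trace (!![0, 1; 0, 0] : Matrix (Fin 2) (Fin 2) ℂ) = 0
  simp [Matrix.trace, Fin.sum_univ_two]⟩

/-- The standard negative root vector `Y` of `sl(2, ℂ)`. -/
def YElt : sl2 := ⟨!![0, 0; 1, 0], by
  change Matrix.trace (!![0, 0; 1, 0] : Matrix (Fin 2) (Fin 2) ℂ) = 0
  simp [Matrix.trace, Fin.sum_univ_two]⟩

theorem trace_eq_zero_of_sl2 (A : sl2) : (A : Matrix (Fin 2) (Fin 2) ℂ).trace = 0 := by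
  have h := A.2
  exact h

/-- The component `A₁ = (A - Aᴴ) / 2` in the decomposition `A = A₁ + i A₂`, `A₁, A₂ ∈ su(2)`, of
`A ∈ sl(2, ℂ)`. -/
def sl2Re (A : sl2) : su2 :=
  ⟨(1 / 2 : ℂ) • ((A : Matrix (Fin 2) (Fin 2) ℂ) - (A : Matrix (Fin 2) (Fin 2) ℂ)ᴴ), by
    refine ⟨?_, ?_⟩
    · rw [Matrix.conjTranspose_smul, Matrix.conjTranspose_sub, Matrix.conjTranspose_conjTranspose,
        ← smul_neg, neg_sub]
      simp
    · rw [Matrix.trace_smul, Matrix.trace_sub, Matrix.trace_conjTranspose, trace_eq_zero_of_sl2]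
      simp⟩

/-- The component `A₂ = (A + Aᴴ) / (2i)` in the decomposition `A = A₁ + i A₂`, `A₁, A₂ ∈ su(2)`,
of `A ∈ sl(2, ℂ)`. -/
def sl2Im (A : sl2) : su2 :=
  ⟨(-I / 2 : ℂ) • ((A : Matrix (Fin 2) (Fin 2) ℂ) + (A : Matrix (Fin 2) (Fin 2) ℂ)ᴴ), by
    refine ⟨?_, ?_⟩
    · rw [Matrix.conjTranspose_smul, Matrix.conjTranspose_add, Matrix.conjTranspose_conjTranspose,
        ← neg_smul, add_comm]
      congr 1
      simp [neg_div]
    · rw [Matrix.trace_smul, Matrix.trace_add, Matrix.trace_conjTranspose, trace_eq_zero_of_sl2]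
      simp⟩

theorem sl2Re_add_sl2Im (A : sl2) :
    (sl2Re A : Matrix (Fin 2) (Fin 2) ℂ) + I • (sl2Im A : Matrix (Fin 2) (Fin 2) ℂ) = A := by
  ext i j
  simp only [sl2Re, sl2Im, Matrix.add_apply, Matrix.smul_apply, Matrix.sub_apply,
    Matrix.conjTranspose_apply, smul_eq_mul]
  linear_combination (-(1 / 2 : ℂ)) * ((A : Matrix (Fin 2) (Fin 2) ℂ) i j +
    star ((A : Matrix (Fin 2) (Fin 2) ℂ) j i)) * Complex.I_mul_I

/-! ### Differentiation along left-invariant vector fields, smooth maps on `SU(2)` -/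

section LieDerivative

variable {V : Type*} [AddCommGroup V] [Module ℝ V] [TopologicalSpace V]

/-- `v` is the derivative at `g` of `f` along the left-invariant vector field `A`. -/
def HasLieDeriv (A : su2) (f : SU2 → V) (g : SU2) (v : V) : Prop :=
  Tendsto (fun t : ℝ => t⁻¹ • (f (g * expSU2 (t • A)) - f g)) (𝓝[≠] 0) (𝓝 v)

/-- The derivative of `f` along the left-invariant vector field `A` of `SU(2)`. -/
def lieDeriv (A : su2) (f : SU2 → V) (g : SU2) : V :=
  haveI : Nonempty V := ⟨0⟩
  limUnder (𝓝[≠] (0 : ℝ)) (fun t : ℝ => t⁻¹ • (f (g * expSU2 (t • A)) - f g))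

/-- `Cⁿ` maps from `SU(2)` to a locally convex space, in terms of the global frame of
left-invariant vector fields: `f` is `C⁰` if it is continuous, and `Cⁿ⁺¹` if it is continuous, has
a linear differential at every point, and its derivatives along all left-invariant vector fields
are `Cⁿ`. -/
def IsCk : ℕ → (SU2 → V) → Prop
  | 0, f => Continuous f
  | n + 1, f => Continuous f ∧ (∀ g, ∃ L : su2 →ₗ[ℝ] V, ∀ A, HasLieDeriv A f g (L A)) ∧
      ∀ A, IsCk n (lieDeriv A f)

/-- Smooth maps from `SU(2)` to a locally convex space. -/
def IsSmooth (f : SU2 → V) : Prop := ∀ n, IsCk n f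

/-- The derivative along the complex left-invariant vector field `A = A₁ + i A₂ ∈ sl(2, ℂ)`. -/
def lieDerivC [Module ℂ V] (A : sl2) (f : SU2 → V) (g : SU2) : V :=
  lieDeriv (sl2Re A) f g + I • lieDeriv (sl2Im A) f g

/-- The Casimir element `Ω = -h²/8 - (XY + YX)/4` (with respect to minus the Killing form), acting
as a second order left-invariant differential operator. -/
def casimir [Module ℂ V] (f : SU2 → V) (g : SU2) : V :=
  -((1 / 8 : ℂ) • lieDerivC hElt (lieDerivC hElt f) g) -
    (1 / 4 : ℂ) • (lieDerivC XElt (lieDerivC YElt f) g + lieDerivC YElt (lieDerivC XElt f) g)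

end LieDerivative

/-! ### Canonical quantization and the harmonic oscillator on the Schwartz space of the line -/

/-- `σ(a) = i x`, for a symplectic basis `a, b`. -/
def sigmaA : 𝓢(ℝ, ℂ) →L[ℂ] 𝓢(ℝ, ℂ) := I • SchwartzMap.smulLeftCLM ℂ (fun x : ℝ => (x : ℂ))

theorem sigmaA_apply (u : 𝓢(ℝ, ℂ)) (x : ℝ) : sigmaA u x = I * x * u x := by
  have h : (fun x : ℝ => (x : ℂ)).HasTemperateGrowth := Complex.ofRealCLM.hasTemperateGrowth
  simp [sigmaA, SchwartzMap.smulLeftCLM_apply_apply h, mul_assoc]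

/-- `σ(b) = d/dx`, for a symplectic basis `a, b`. -/
def sigmaB : 𝓢(ℝ, ℂ) →L[ℂ] 𝓢(ℝ, ℂ) := SchwartzMap.derivCLM ℂ ℂ

/-- The harmonic oscillator `H₀ = (σ(a)² + σ(b)²) / 2 = (-x² + d²/dx²) / 2`. -/
def oscillator : 𝓢(ℝ, ℂ) →L[ℂ] 𝓢(ℝ, ℂ) :=
  (1 / 2 : ℂ) • (sigmaA.comp sigmaA + sigmaB.comp sigmaB)

/-! ### Hermite functions and the metaplectic representation of the circle -/

theorem abs_pow_mul_gauss_le (n : ℕ) :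
    ∃ C : ℝ, ∀ x : ℝ, |x| ^ n * Real.exp (-(x ^ 2 / 2)) ≤ C := by
  refine ⟨1 + 2 ^ n * n.factorial, fun x => ?_⟩
  have h1 : |x| ^ n ≤ 1 + (x ^ 2) ^ n := by
    have h : (x ^ 2) ^ n = (|x| ^ n) ^ 2 := by rw [← sq_abs, ← pow_mul, ← pow_mul, mul_comm]
    rw [h]
    nlinarith [sq_nonneg (|x| ^ n - 1), pow_nonneg (abs_nonneg x) n]
  have h2 : (x ^ 2) ^ n ≤ 2 ^ n * n.factorial * Real.exp (x ^ 2 / 2) := by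
    have h := Real.pow_div_factorial_le_exp (x ^ 2 / 2) (by positivity) n
    rw [div_pow, div_div, div_le_iff₀ (by positivity)] at h
    linarith
  have h3 : Real.exp (-(x ^ 2 / 2)) ≤ 1 := by
    rw [Real.exp_le_one_iff]
    have := sq_nonneg x
    linarith
  have h4 : Real.exp (x ^ 2 / 2) * Real.exp (-(x ^ 2 / 2)) = 1 := by
    rw [← Real.exp_add, add_neg_cancel, Real.exp_zero]
  have h5 := Real.exp_pos (-(x ^ 2 / 2))
  calc |x| ^ n * Real.exp (-(x ^ 2 / 2))
      ≤ (1 + 2 ^ n * n.factorial * Real.exp (x ^ 2 / 2)) * Real.exp (-(x ^ 2 / 2)) := by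
        gcongr
        linarith
    _ = Real.exp (-(x ^ 2 / 2)) +
        2 ^ n * n.factorial * (Real.exp (x ^ 2 / 2) * Real.exp (-(x ^ 2 / 2))) := by ring
    _ ≤ 1 + 2 ^ n * n.factorial := by rw [h4]; linarith

theorem abs_pow_mul_poly_gauss_le (k : ℕ) (p : Polynomial ℝ) :
    ∃ C : ℝ, ∀ x : ℝ, |x| ^ k * |p.eval x * Real.exp (-(x ^ 2 / 2))| ≤ C := by
  induction p using Polynomial.induction_on' with
  | add p q hp hq =>
    obtain ⟨C, hC⟩ := hp
    obtain ⟨C', hC'⟩ := hq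
    refine ⟨C + C', fun x => ?_⟩
    rw [Polynomial.eval_add, add_mul]
    have h := mul_le_mul_of_nonneg_left (abs_add_le (p.eval x * Real.exp (-(x ^ 2 / 2)))
      (q.eval x * Real.exp (-(x ^ 2 / 2)))) (pow_nonneg (abs_nonneg x) k)
    linarith [hC x, hC' x]
  | monomial n a =>
    obtain ⟨C, hC⟩ := abs_pow_mul_gauss_le (k + n)
    refine ⟨|a| * C, fun x => ?_⟩
    have h := mul_le_mul_of_nonneg_left (hC x) (abs_nonneg a)
    rw [Polynomial.eval_monomial, abs_mul, abs_mul, abs_pow, abs_of_pos (Real.exp_pos _)]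
    calc _ = |a| * (|x| ^ (k + n) * Real.exp (-(x ^ 2 / 2))) := by ring
      _ ≤ _ := h

theorem deriv_poly_gauss (c : ℝ) (p : Polynomial ℝ) :
    deriv (fun x : ℝ => p.eval x * Real.exp (-(c * x ^ 2))) =
      fun x => (p.derivative - Polynomial.C (2 * c) * Polynomial.X * p).eval x *
        Real.exp (-(c * x ^ 2)) := by
  funext x
  have h1 : HasDerivAt (fun x : ℝ => Real.exp (-(c * x ^ 2)))
      (Real.exp (-(c * x ^ 2)) * (-(c * (2 * x)))) x := by
    have h := (((hasDerivAt_pow 2 x).const_mul c).neg).exp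
    simpa using h
  have h2 := (p.hasDerivAt x).mul h1
  refine (HasDerivAt.deriv h2).trans ?_
  simp only [Polynomial.eval_sub, Polynomial.eval_mul, Polynomial.eval_C, Polynomial.eval_X]
  ring

theorem iteratedDeriv_poly_gauss (c : ℝ) (n : ℕ) (p : Polynomial ℝ) :
    ∃ q : Polynomial ℝ, iteratedDeriv n (fun x : ℝ => p.eval x * Real.exp (-(c * x ^ 2))) =
      fun x => q.eval x * Real.exp (-(c * x ^ 2)) := by
  induction n generalizing p with
  | zero => exact ⟨p, by simp⟩
  | succ n ih =>
    obtain ⟨q, hq⟩ := ih (p.derivative - Polynomial.C (2 * c) * Polynomial.X * p)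
    exact ⟨q, by rw [iteratedDeriv_succ', deriv_poly_gauss, hq]⟩

/-- The Hermite function `h_m(t) = exp(t²/2) (dᵐ/dtᵐ) exp(-t²)`. -/
def hermiteFunReal (m : ℕ) (t : ℝ) : ℝ :=
  Real.exp (t ^ 2 / 2) * iteratedDeriv m (fun s : ℝ => Real.exp (-s ^ 2)) t

theorem hermiteFunReal_eq (m : ℕ) :
    ∃ q : Polynomial ℝ, hermiteFunReal m = fun x => q.eval x * Real.exp (-(1 / 2 * x ^ 2)) := by
  obtain ⟨q, hq⟩ := iteratedDeriv_poly_gauss 1 m 1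
  refine ⟨q, ?_⟩
  simp only [Polynomial.eval_one, one_mul] at hq
  funext x
  rw [hermiteFunReal, hq, mul_left_comm, ← Real.exp_add]
  ring_nf

/-- The Hermite function `h_m`, as a real Schwartz function. -/
def hermiteFunSchwartz (m : ℕ) : 𝓢(ℝ, ℝ) where
  toFun := hermiteFunReal m
  smooth' := by
    obtain ⟨q, hq⟩ := hermiteFunReal_eq m
    rw [hq]
    exact (by simpa [Polynomial.aeval_def] using q.contDiff_aeval (𝕜 := ℝ) (n := ∞) :
      ContDiff ℝ ∞ fun x => q.eval x).mul (by fun_prop)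
  decay' := by
    intro k n
    obtain ⟨q, hq⟩ := hermiteFunReal_eq m
    obtain ⟨r, hr⟩ := iteratedDeriv_poly_gauss (1 / 2) n q
    obtain ⟨C, hC⟩ := abs_pow_mul_poly_gauss_le k r
    refine ⟨C, fun x => ?_⟩
    rw [norm_iteratedFDeriv_eq_norm_iteratedDeriv, hq, hr, Real.norm_eq_abs, Real.norm_eq_abs]
    have h := hC x
    rwa [show -(x ^ 2 / 2) = -(1 / 2 * x ^ 2) by ring] at h

/-- The Hermite function `h_m`, as a complex-valued Schwartz function. -/
def hermiteFun (m : ℕ) : 𝓢(ℝ, ℂ) := (hermiteFunSchwartz m).postcompCLM Complex.ofRealCLM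

theorem hermiteFun_apply (m : ℕ) (t : ℝ) : hermiteFun m t =
    ((Real.exp (t ^ 2 / 2) * iteratedDeriv m (fun s : ℝ => Real.exp (-s ^ 2)) t : ℝ) : ℂ) := rfl

/-- The line in `L²(ℝ)` spanned by the Hermite function `h_l`, on which the oscillator has
eigenvalue `-(l + 1/2)`. -/
abbrev hermiteLine (l : ℕ) : Submodule ℂ (Lp ℂ 2 (volume : Measure ℝ)) :=
  Submodule.span ℂ {(hermiteFun l).toLp 2 volume}

/-- The metaplectic representation on `L²(ℝ)` of the double cover `Ũ(1) = Circle → U(1)`,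
`z ↦ z²`, of `U(1) ⊂ Sp(2, ℝ)`. The complex structure `J` acts by `m_*(J) = -i H₀`, hence by
`i (l + 1/2)` on `h_l`, and the element `z = exp(i s / 2)` over `exp(s J) ∈ U(1)` acts on `h_l` by
`exp(i s (l + 1/2)) = z ^ (2 l + 1)`. -/
def metaplectic (z : Circle) (u : Lp ℂ 2 (volume : Measure ℝ)) : Lp ℂ 2 (volume : Measure ℝ) :=
  ∑' l : ℕ, ((z : ℂ) ^ (2 * l + 1)) • (hermiteLine l).starProjection u

/-! ### Symplectic spinors on `ℂP¹ = SU(2) / U(1)` -/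

/-- Smooth sections of the bundle `SU(2) ×_{m ∘ Ãd} 𝓢(ℝ)` of metaplectic spinors, as smooth maps
`f` on `SU(2)` with `f (g t) = m(Ãd(t⁻¹)) f(g)` for `t ∈ T`. The adjoint action of
`t = diag(z, z̄)` on `𝔱^⊥` is the rotation `z²`, so its lift `Ãd(t)` to `Ũ(1)` is `z`. -/
def spinorSections : Set (SU2 → 𝓢(ℝ, ℂ)) :=
  {f | IsSmooth f ∧ ∀ (g : SU2) (z : Circle),
    (f (g * torus z)).toLp 2 volume = metaplectic z⁻¹ ((f g).toLp 2 volume)}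

/-- `E, F` is an oriented orthonormal basis of `𝔱^⊥`, for minus the Killing form, such that
`Z = (E - i F) / 2` is a root vector for the positive root. Then `F = J E`, and `E, F` is a
symplectic basis. -/
structure IsRootFrame (E F : su2) : Prop where
  perp_E : killingForm ℝ su2 (sl2Im hElt) E = 0
  perp_F : killingForm ℝ su2 (sl2Im hElt) F = 0
  norm_E : -killingForm ℝ su2 E E = 1
  norm_F : -killingForm ℝ su2 F F = 1
  orth : killingForm ℝ su2 E F = 0
  root : ⁅(hElt : Matrix (Fin 2) (Fin 2) ℂ),
      (1 / 2 : ℂ) • ((E : Matrix (Fin 2) (Fin 2) ℂ) - I • (F : Matrix (Fin 2) (Fin 2) ℂ))⁆ =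
    (2 : ℂ) •
      ((1 / 2 : ℂ) • ((E : Matrix (Fin 2) (Fin 2) ℂ) - I • (F : Matrix (Fin 2) (Fin 2) ℂ)))

/-- The oscillator `H` acting fibrewise. -/
def opH (f : SU2 → 𝓢(ℝ, ℂ)) (g : SU2) : 𝓢(ℝ, ℂ) := oscillator (f g)

/-- The symplectic Dirac operator `D = σ(E) ∇_F - σ(F) ∇_E`. The spinor connection is
differentiation along left-invariant vector fields in `𝔱^⊥`. -/
def opD (E F : su2) (f : SU2 → 𝓢(ℝ, ℂ)) (g : SU2) : 𝓢(ℝ, ℂ) :=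
  sigmaA (lieDeriv F f g) - sigmaB (lieDeriv E f g)

/-- The symplectic Dirac operator `D̃ = σ(E) ∇_E + σ(F) ∇_F`. -/
def opDt (E F : su2) (f : SU2 → 𝓢(ℝ, ℂ)) (g : SU2) : 𝓢(ℝ, ℂ) :=
  sigmaA (lieDeriv E f g) + sigmaB (lieDeriv F f g)

/-- The symplectic Dolbeault operator `𝒟 = D + i D̃`. -/
def dolb (E F : su2) (f : SU2 → 𝓢(ℝ, ℂ)) : SU2 → 𝓢(ℝ, ℂ) := opD E F f + I • opDt E F f

/-- The symplectic Dolbeault operator `𝒟̄ = D - i D̃`. -/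
def dolbBar (E F : su2) (f : SU2 → 𝓢(ℝ, ℂ)) : SU2 → 𝓢(ℝ, ℂ) := opD E F f - I • opDt E F f

/-- The second order operator `P = i [D̃, D]`. -/
def opP (E F : su2) (f : SU2 → 𝓢(ℝ, ℂ)) : SU2 → 𝓢(ℝ, ℂ) :=
  I • (opDt E F (opD E F f) - opD E F (opDt E F f))

end CP1

end

noncomputable section

namespace CP1

/-! ### One-parameter subgroups of `SU(2)` -/

/-! Write `a = σ(E)`, `b = σ(F)`, so `[b, a] = i`, and let `e₃ = ih/2`. For any root frame `[E, F] =
e₃/2`, `[e₃, E] = F`, `[e₃, F] = -E`. Fibre operators commute with left-invariant derivatives, so on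
all smooth maps `P = i H e₃ - (E² + F²)` (`commEnd_apply`) and `Ω = E² + F² + e₃²/2`
(`coe_casimirEnd`). Equivariance enters through its derivative along the torus: on sections `e₃ =
iH` (`lieDeriv_e₃_eq`). Substitution gives `P = -Ω - (3/2) H²`.

The Casimir operator commutes with `D` and `D̃`, while `[H, D] = iD̃` and `[H, D̃] = -iD`; that is,
`[H, 𝒟] = 𝒟` and `[H, 𝒟̄] = -𝒟̄`. Hence `[P, 𝒟] = -(3/2)(H𝒟 + 𝒟H) = -3𝒟H - (3/2)𝒟`, and similarly
for `𝒟̄`.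

The analysis rests on Hermite coefficients. Hermite functions are complete in `L²`
(`eq_zero_of_inner_hermiteFun_eq_zero`), so a Schwartz function is determined by its coefficients
and the metaplectic condition becomes one scalar equation for each `l` (`toLp_eq_metaplectic_iff`).
The commutator formula for Lie derivatives also reduces to complex-valued functions in this way.
Sections are preserved because `𝒟 = -(b - ia)(E - iF)`: the torus weight of the root vector cancels
the shift of Hermite index caused by the ladder operator. -/

open scoped Matrix.Norms.Operator in
theorem hasDerivAt_matrix_exp_smul (A : Matrix (Fin 2) (Fin 2) ℂ) (t : ℝ) (i j : Fin 2) :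
    HasDerivAt (fun s : ℝ => NormedSpace.exp (s • A) i j) ((NormedSpace.exp (t • A) * A) i j) t := by
  have h := hasDerivAt_exp_smul_const (𝕂 := ℝ) A t
  exact (hasDerivAt_pi.1 (hasDerivAt_pi.1 h i)) j

theorem continuous_expSU2_smul (A : su2) : Continuous fun t : ℝ => expSU2 (t • A) := by
  refine Continuous.subtype_mk ?_ _
  refine continuous_matrix fun i j => ?_
  refine continuous_iff_continuousAt.2 fun t => ?_
  exact (hasDerivAt_matrix_exp_smul (A : Matrix (Fin 2) (Fin 2) ℂ) t i j).continuousAt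

theorem expSU2_add_smul (A : su2) (s t : ℝ) :
    expSU2 ((s + t) • A) = expSU2 (s • A) * expSU2 (t • A) := by
  apply Subtype.ext
  change NormedSpace.exp ((s + t) • (A : Matrix (Fin 2) (Fin 2) ℂ)) =
    NormedSpace.exp (s • (A : Matrix (Fin 2) (Fin 2) ℂ)) *
      NormedSpace.exp (t • (A : Matrix (Fin 2) (Fin 2) ℂ))
  rw [add_smul]
  exact Matrix.exp_add_of_commute _ _ (((Commute.refl _).smul_left s).smul_right t)

@[simp]
theorem expSU2_zero : expSU2 0 = 1 := by
  apply Subtype.ext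
  exact NormedSpace.exp_zero

theorem SU2_mul_conjTranspose (u : SU2) :
    (u : Matrix (Fin 2) (Fin 2) ℂ) * (u : Matrix (Fin 2) (Fin 2) ℂ)ᴴ = 1 :=
  Matrix.mem_unitaryGroup_iff.1 (Matrix.mem_specialUnitaryGroup_iff.1 u.2).1

/-- The inverse adjoint action `A ↦ u⁻¹ A u` of `SU(2)` on `su(2)`. -/
def adInv (u : SU2) (A : su2) : su2 :=
  ⟨(u : Matrix (Fin 2) (Fin 2) ℂ)ᴴ * A * u, by
    obtain ⟨A, hA, htr⟩ := A
    refine ⟨?_, ?_⟩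
    · simp [Matrix.conjTranspose_mul, hA, mul_assoc]
    · rw [Matrix.trace_mul_comm, ← mul_assoc, SU2_mul_conjTranspose, one_mul, htr]⟩

theorem adInv_smul (u : SU2) (t : ℝ) (A : su2) : adInv u (t • A) = t • adInv u A := by
  apply Subtype.ext
  simp [adInv]

/-- This moves an exponential past a right translation by `u`, at the price of conjugating its
direction. -/
theorem expSU2_mul (u : SU2) (A : su2) : expSU2 A * u = u * expSU2 (adInv u A) := by
  apply Subtype.ext
  have hu := SU2_mul_conjTranspose u
  have hi : (u : Matrix (Fin 2) (Fin 2) ℂ)⁻¹ = (u : Matrix (Fin 2) (Fin 2) ℂ)ᴴ :=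
    Matrix.inv_eq_right_inv hu
  have hun : IsUnit (u : Matrix (Fin 2) (Fin 2) ℂ) := IsUnit.of_mul_eq_one _ hu
  have h := Matrix.exp_conj' (u : Matrix (Fin 2) (Fin 2) ℂ) (A : Matrix (Fin 2) (Fin 2) ℂ) hun
  rw [hi] at h
  change NormedSpace.exp (A : Matrix (Fin 2) (Fin 2) ℂ) * (u : Matrix (Fin 2) (Fin 2) ℂ) =
    (u : Matrix (Fin 2) (Fin 2) ℂ) * NormedSpace.exp ((u : Matrix (Fin 2) (Fin 2) ℂ)ᴴ *
      (A : Matrix (Fin 2) (Fin 2) ℂ) * (u : Matrix (Fin 2) (Fin 2) ℂ))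
  rw [h, ← mul_assoc, ← mul_assoc, hu, one_mul]

theorem expSU2_smul_mul (u : SU2) (A : su2) (t : ℝ) :
    expSU2 (t • A) * u = u * expSU2 (t • adInv u A) := by
  rw [expSU2_mul, adInv_smul]

/-! ### The standard basis of `su(2)` -/

/-- The basis vector `(X - Y) / 2` of `su(2)`. -/
def e₁ : su2 := ⟨!![0, 1 / 2; -1 / 2, 0], by
  constructor
  · ext i j
    fin_cases i <;> fin_cases j <;> simp [Matrix.conjTranspose_apply, neg_div]
  · simp [Matrix.trace, Fin.sum_univ_two]⟩

/-- The basis vector `i (X + Y) / 2` of `su(2)`. -/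
def e₂ : su2 := ⟨!![0, I / 2; I / 2, 0], by
  constructor
  · ext i j
    fin_cases i <;> fin_cases j <;> simp [Matrix.conjTranspose_apply, neg_div]
  · simp [Matrix.trace, Fin.sum_univ_two]⟩

/-- The basis vector `i h / 2` of `su(2)`. -/
def e₃ : su2 := ⟨!![I / 2, 0; 0, -I / 2], by
  constructor
  · ext i j
    fin_cases i <;> fin_cases j <;> simp [Matrix.conjTranspose_apply, neg_div]
  · simp [Matrix.trace, Fin.sum_univ_two, neg_div]⟩

/-- Skew-Hermitian and traceless matrices are determined by their entries `(0,0)` and `(0,1)`; the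
factors 2 undo the halves in `e₁`, `e₂`, `e₃`. -/
theorem su2_eq (A : su2) :
    A = (2 * (A.1 0 1).re) • e₁ + (2 * (A.1 0 1).im) • e₂ + (2 * (A.1 0 0).im) • e₃ := by
  obtain ⟨A, hA, htr⟩ := A
  have h00 := congrFun (congrFun hA 0) 0
  have h10 := congrFun (congrFun hA 1) 0
  have h11 : A 0 0 + A 1 1 = 0 := by simpa [Matrix.trace, Fin.sum_univ_two] using htr
  simp only [Matrix.conjTranspose_apply, Matrix.neg_apply] at h00 h10
  have a1 := congrArg Complex.re h00
  have a2 := congrArg Complex.re h10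
  have a3 := congrArg Complex.im h10
  have a4 := congrArg Complex.re h11
  have a5 := congrArg Complex.im h11
  simp at a1 a2 a3 a4 a5
  apply Subtype.ext
  ext i j
  apply Complex.ext <;> fin_cases i <;> fin_cases j <;> simp [e₁, e₂, e₃] <;> linarith

theorem lie_e₁_e₂ : ⁅e₁, e₂⁆ = e₃ := by
  apply Subtype.ext
  rw [LieSubalgebra.coe_bracket, LieRing.of_associative_ring_bracket]
  ext i j
  apply Complex.ext <;> fin_cases i <;> fin_cases j <;>
    simp [e₁, e₂, e₃] <;> norm_num

theorem lie_e₂_e₃ : ⁅e₂, e₃⁆ = e₁ := by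
  apply Subtype.ext
  rw [LieSubalgebra.coe_bracket, LieRing.of_associative_ring_bracket]
  ext i j
  apply Complex.ext <;> fin_cases i <;> fin_cases j <;>
    simp [e₁, e₂, e₃] <;> norm_num

theorem lie_e₃_e₁ : ⁅e₃, e₁⁆ = e₂ := by
  apply Subtype.ext
  rw [LieSubalgebra.coe_bracket, LieRing.of_associative_ring_bracket]
  ext i j
  apply Complex.ext <;> fin_cases i <;> fin_cases j <;>
    simp [e₁, e₂, e₃] <;> norm_num

/-! ### Calculus of Lie derivatives -/

section LieDerivative

variable {V : Type*} [AddCommGroup V] [Module ℝ V] [TopologicalSpace V]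
variable {W : Type*} [AddCommGroup W] [Module ℝ W] [TopologicalSpace W]

theorem HasLieDeriv.lieDeriv_eq [T2Space V] {A : su2} {f : SU2 → V} {g : SU2} {v : V}
    (h : HasLieDeriv A f g v) : lieDeriv A f g = v :=
  Tendsto.limUnder_eq h

theorem HasLieDeriv.clm {A : su2} {f : SU2 → V} {g : SU2} {v : V} (h : HasLieDeriv A f g v)
    (T : V →L[ℝ] W) : HasLieDeriv A (T ∘ f) g (T v) := by
  have h' := (T.continuous.tendsto v).comp h
  refine h'.congr fun t => ?_
  simp

theorem HasLieDeriv.add [ContinuousAdd V] {A : su2} {f₁ f₂ : SU2 → V} {g : SU2} {v₁ v₂ : V}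
    (h₁ : HasLieDeriv A f₁ g v₁) (h₂ : HasLieDeriv A f₂ g v₂) :
    HasLieDeriv A (f₁ + f₂) g (v₁ + v₂) := by
  refine (Tendsto.add h₁ h₂).congr fun t => ?_
  simp only [Pi.add_apply, ← smul_add]
  congr 1
  abel

theorem IsCk.hasLieDeriv [T2Space V] {n : ℕ} {f : SU2 → V} (h : IsCk (n + 1) f) (A : su2)
    (g : SU2) : HasLieDeriv A f g (lieDeriv A f g) := by
  obtain ⟨L, hL⟩ := h.2.1 g
  rw [(hL A).lieDeriv_eq]
  exact hL A

theorem IsCk.clm [T2Space V] [T2Space W] (T : V →L[ℝ] W) {n : ℕ} {f : SU2 → V} (h : IsCk n f) :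
    IsCk n (T ∘ f) := by
  induction n generalizing f with
  | zero => exact T.continuous.comp h
  | succ n ih =>
    refine ⟨T.continuous.comp h.1, fun g => ?_, fun A => ?_⟩
    · obtain ⟨L, hL⟩ := h.2.1 g
      exact ⟨T.toLinearMap ∘ₗ L, fun A => (hL A).clm T⟩
    · have e : lieDeriv A (T ∘ f) = T ∘ lieDeriv A f :=
        funext fun g => ((h.hasLieDeriv A g).clm T).lieDeriv_eq
      rw [e]
      exact ih (h.2.2 A)

theorem IsCk.add [T2Space V] [ContinuousAdd V] {n : ℕ} {f₁ f₂ : SU2 → V} (h₁ : IsCk n f₁)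
    (h₂ : IsCk n f₂) : IsCk n (f₁ + f₂) := by
  induction n generalizing f₁ f₂ with
  | zero => exact Continuous.add h₁ h₂
  | succ n ih =>
    refine ⟨h₁.1.add h₂.1, fun g => ?_, fun A => ?_⟩
    · obtain ⟨L₁, hL₁⟩ := h₁.2.1 g
      obtain ⟨L₂, hL₂⟩ := h₂.2.1 g
      exact ⟨L₁ + L₂, fun A => (hL₁ A).add (hL₂ A)⟩
    · have e : lieDeriv A (f₁ + f₂) = lieDeriv A f₁ + lieDeriv A f₂ :=
        funext fun g => ((h₁.hasLieDeriv A g).add (h₂.hasLieDeriv A g)).lieDeriv_eq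
      rw [e]
      exact ih (h₁.2.2 A) (h₂.2.2 A)

namespace IsSmooth

theorem continuous {f : SU2 → V} (h : IsSmooth f) : Continuous f := h 0

theorem lieDeriv {f : SU2 → V} (h : IsSmooth f) (A : su2) : IsSmooth (lieDeriv A f) :=
  fun n => (h (n + 1)).2.2 A

variable [T2Space V]

theorem hasLieDeriv {f : SU2 → V} (h : IsSmooth f) (A : su2) (g : SU2) :
    HasLieDeriv A f g (CP1.lieDeriv A f g) := (h 1).hasLieDeriv A g

theorem lieDeriv_add_left {f : SU2 → V} (h : IsSmooth f) (A B : su2) :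
    CP1.lieDeriv (A + B) f = CP1.lieDeriv A f + CP1.lieDeriv B f := by
  funext g
  obtain ⟨L, hL⟩ := (h 1).2.1 g
  rw [Pi.add_apply, (hL _).lieDeriv_eq, (hL A).lieDeriv_eq, (hL B).lieDeriv_eq, map_add]

theorem lieDeriv_smul_left {f : SU2 → V} (h : IsSmooth f) (c : ℝ) (A : su2) :
    CP1.lieDeriv (c • A) f = c • CP1.lieDeriv A f := by
  funext g
  obtain ⟨L, hL⟩ := (h 1).2.1 g
  rw [Pi.smul_apply, (hL _).lieDeriv_eq, (hL A).lieDeriv_eq, map_smul]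

/-- For a direction that varies with a parameter, this reduces continuity and differentiability to
the coefficients and three fixed derivatives. -/
theorem lieDeriv_eq_basis {f : SU2 → V} (h : IsSmooth f) (A : su2) (g : SU2) :
    CP1.lieDeriv A f g = (2 * (A.1 0 1).re) • CP1.lieDeriv e₁ f g +
      (2 * (A.1 0 1).im) • CP1.lieDeriv e₂ f g + (2 * (A.1 0 0).im) • CP1.lieDeriv e₃ f g := by
  conv_lhs => rw [su2_eq A]
  rw [h.lieDeriv_add_left, h.lieDeriv_add_left, h.lieDeriv_smul_left, h.lieDeriv_smul_left,
    h.lieDeriv_smul_left]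
  rfl

theorem clm [T2Space W] (T : V →L[ℝ] W) {f : SU2 → V} (h : IsSmooth f) : IsSmooth (T ∘ f) :=
  fun n => (h n).clm T

theorem lieDeriv_clm [T2Space W] (T : V →L[ℝ] W) {f : SU2 → V} (h : IsSmooth f) (A : su2) :
    CP1.lieDeriv A (T ∘ f) = T ∘ CP1.lieDeriv A f :=
  funext fun g => ((h.hasLieDeriv A g).clm T).lieDeriv_eq

theorem add [ContinuousAdd V] {f₁ f₂ : SU2 → V} (h₁ : IsSmooth f₁) (h₂ : IsSmooth f₂) :
    IsSmooth (f₁ + f₂) := fun n => (h₁ n).add (h₂ n)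

theorem lieDeriv_add [ContinuousAdd V] {f₁ f₂ : SU2 → V} (h₁ : IsSmooth f₁) (h₂ : IsSmooth f₂)
    (A : su2) : CP1.lieDeriv A (f₁ + f₂) = CP1.lieDeriv A f₁ + CP1.lieDeriv A f₂ :=
  funext fun g => ((h₁.hasLieDeriv A g).add (h₂.hasLieDeriv A g)).lieDeriv_eq

end IsSmooth

theorem isSmooth_zero [T2Space V] : IsSmooth (0 : SU2 → V) := by
  intro n
  induction n with
  | zero => exact continuous_zero
  | succ n ih =>
    have h : ∀ A g, HasLieDeriv A (0 : SU2 → V) g 0 := fun A g => by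
      simp [HasLieDeriv]
    refine ⟨continuous_zero, fun g => ⟨0, fun A => h A g⟩, fun A => ?_⟩
    rwa [show lieDeriv A (0 : SU2 → V) = 0 from funext fun g => (h A g).lieDeriv_eq]

end LieDerivative

/-! ### The commutator of Lie derivatives -/

/-- Symmetry of mixed partial derivatives, for a function of which only one of the two is known
to exist. -/
theorem hasDerivAt_mixed_partial {φ φt ψ : ℝ → ℝ → ℂ} {φs : ℝ → ℂ}
    (hs : ∀ t, HasDerivAt (fun s => φ s t) (φs t) 0)
    (ht : ∀ s t, HasDerivAt (fun t => φ s t) (φt s t) t)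
    (hst : ∀ s t, HasDerivAt (fun s => φt s t) (ψ s t) s)
    (hψ : ContinuousAt (Function.uncurry ψ) (0, 0)) : HasDerivAt φs (ψ 0 0) 0 := by
  rw [hasDerivAt_iff_isLittleO_nhds_zero, Asymptotics.isLittleO_iff]
  intro c hc
  obtain ⟨δ, hδ, hψδ⟩ := Metric.continuousAt_iff.1 hψ c hc
  have hbd : ∀ s t : ℝ, |s| < δ → |t| < δ → ‖ψ s t - ψ 0 0‖ ≤ c := by
    intro s t h1 h2
    have h := hψδ (x := (s, t)) (by simp [Prod.dist_eq, h1, h2])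
    rw [dist_eq_norm] at h
    exact h.le
  have hball : ∀ s : ℝ, s ∈ Metric.ball (0 : ℝ) δ ↔ |s| < δ := fun s => by simp
  -- The mean value inequality is applied twice, here in `s` and in `key2` in `t`, to bound the
  -- second difference of `φ`.
  have key1 : ∀ s t : ℝ, |s| < δ → |t| < δ → ‖φt s t - φt 0 t - s • ψ 0 0‖ ≤ c * |s| := by
    intro s t h1 h2
    have h := Convex.norm_image_sub_le_of_norm_hasDerivWithin_le
      (f := fun s => φt s t - s • ψ 0 0) (f' := fun s => ψ s t - ψ 0 0)
      (s := Metric.ball (0 : ℝ) δ) (x := 0) (y := s) (C := c)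
      (fun x _ => by
        simpa using! ((hst x t).sub ((hasDerivAt_id x).smul_const (ψ 0 0))).hasDerivWithinAt)
      (fun x hx => hbd x t ((hball x).1 hx) h2) (convex_ball _ _) (by simpa using hδ)
      ((hball s).2 h1)
    simpa [sub_right_comm] using h
  have key2 : ∀ s t : ℝ, |s| < δ → |t| < δ →
      ‖(φ s t - φ s 0 - s • t • ψ 0 0) - (φ 0 t - φ 0 0)‖ ≤ c * |t| * |s| := by
    intro s t h1 h2
    have h := Convex.norm_image_sub_le_of_norm_hasDerivWithin_le
      (f := fun t => φ s t - φ 0 t - t • s • ψ 0 0) (f' := fun t => φt s t - φt 0 t - s • ψ 0 0)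
      (s := Metric.ball (0 : ℝ) δ) (x := 0) (y := t) (C := c * |s|)
      (fun x _ => by
        simpa using! (((ht s x).sub (ht 0 x)).sub
          ((hasDerivAt_id x).smul_const (s • ψ 0 0))).hasDerivWithinAt)
      (fun x hx => key1 s x h1 ((hball x).1 hx)) (convex_ball _ _) (by simpa using hδ)
      ((hball t).2 h2)
    calc _ = ‖(φ s t - φ 0 t - t • s • ψ 0 0) - (φ s 0 - φ 0 0 - (0 : ℝ) • s • ψ 0 0)‖ := by
          congr 1
          rw [smul_comm s t, zero_smul]
          ring
      _ ≤ c * |s| * ‖t - 0‖ := h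
      _ = _ := by rw [sub_zero, Real.norm_eq_abs]; ring
  filter_upwards [Metric.ball_mem_nhds (0 : ℝ) hδ] with t ht'
  have ht' := (hball t).1 ht'
  have hd : HasDerivAt (fun s => φ s t - φ s 0 - s • t • ψ 0 0) (φs t - φs 0 - t • ψ 0 0) 0 := by
    simpa using! ((hs t).sub (hs 0)).sub ((hasDerivAt_id (0 : ℝ)).smul_const (t • ψ 0 0))
  rw [zero_add, Real.norm_eq_abs]
  -- `key2` is a Lipschitz bound at `s = 0` with constant `c * |t|`, and the derivative in `s`
  -- inherits it.
  refine hd.le_of_lip' (by positivity) ?_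
  filter_upwards [Metric.ball_mem_nhds (0 : ℝ) hδ] with s hs'
  simpa using! key2 s t ((hball s).1 hs') ht'

/-- Product rule for `exp(-tB) A exp(tB)`. The inverse adjoint action gives `AB - BA`, hence `⁅A,
B⁆` rather than `⁅B, A⁆`. -/
theorem hasDerivAt_adInv_apply (A B : su2) (i j : Fin 2) :
    HasDerivAt (fun t : ℝ => (adInv (expSU2 (t • B)) A).1 i j) ((⁅A, B⁆ : su2).1 i j) 0 := by
  have h : ∀ i j, HasDerivAt (fun t : ℝ => (expSU2 (t • B)).1 i j) (B.1 i j) 0 := fun i j => by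
    simpa using! hasDerivAt_matrix_exp_smul B.1 0 i j
  have hs : ∀ i j, star (B.1 i j) = -B.1 j i := fun i j => congrFun (congrFun B.2.1 j) i
  have H := HasDerivAt.fun_sum (u := Finset.univ) fun k (_ : k ∈ Finset.univ) =>
    (HasDerivAt.fun_sum (u := Finset.univ) fun l (_ : l ∈ Finset.univ) =>
      ((h l i).star.mul_const (A.1 l k))).mul (h k j)
  have e1 : (fun t : ℝ => (adInv (expSU2 (t • B)) A).1 i j) = fun t : ℝ =>
      ∑ k, (∑ l, star ((expSU2 (t • B)).1 l i) * A.1 l k) * (expSU2 (t • B)).1 k j := by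
    funext t
    simp [adInv, Matrix.mul_apply, Matrix.conjTranspose_apply]
  rw [e1]
  refine HasDerivAt.congr_deriv H ?_
  rw [LieSubalgebra.coe_bracket, LieRing.of_associative_ring_bracket]
  fin_cases i <;> fin_cases j <;>
    simp [hs, Fin.sum_univ_two, Matrix.mul_apply] <;> ring

theorem continuous_adInv_apply (A : su2) (i j : Fin 2) :
    Continuous fun u : SU2 => (adInv u A).1 i j := by
  have h : Continuous fun u : SU2 => ((u : Matrix (Fin 2) (Fin 2) ℂ)ᴴ * A.1 * u) :=
    (continuous_subtype_val.matrix_conjTranspose.matrix_mul continuous_const).matrix_mul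
      continuous_subtype_val
  exact h.matrix_elem i j

theorem adInv_one (A : su2) : adInv 1 A = A := by
  apply Subtype.ext
  simp [adInv]

theorem IsSmooth.hasDerivAt_mul_right {f : SU2 → ℂ} (hf : IsSmooth f) (A : su2) (g u : SU2)
    (t : ℝ) : HasDerivAt (fun s : ℝ => f (g * expSU2 (s • A) * u))
      (CP1.lieDeriv (adInv u A) f (g * expSU2 (t • A) * u)) t := by
  rw [hasDerivAt_iff_tendsto_slope_zero]
  refine (hf.hasLieDeriv (adInv u A) (g * expSU2 (t • A) * u)).congr fun s => ?_
  rw [expSU2_add_smul, mul_assoc _ u, ← expSU2_smul_mul, ← mul_assoc, ← mul_assoc]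

theorem IsSmooth.hasDerivAt {f : SU2 → ℂ} (hf : IsSmooth f) (A : su2) (g : SU2) (t : ℝ) :
    HasDerivAt (fun s : ℝ => f (g * expSU2 (s • A))) (CP1.lieDeriv A f (g * expSU2 (t • A))) t := by
  simpa [adInv_one] using hf.hasDerivAt_mul_right A g 1 t

/-- Take `φ(s, t) = f(g exp(sA) exp(tB))`. Its `s`-derivative at 0 is the derivative of `f` at `g
exp(tB)` along `exp(-tB) A exp(tB)`. The `t`-derivative of this at 0 is `A(Bf)` by symmetry of mixed
partials, and `⁅A, B⁆f + B(Af)` by the product rule. -/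
theorem IsSmooth.lieDeriv_lie {f : SU2 → ℂ} (hf : IsSmooth f) (A B : su2) (g : SU2) :
    CP1.lieDeriv ⁅A, B⁆ f g =
      CP1.lieDeriv A (CP1.lieDeriv B f) g - CP1.lieDeriv B (CP1.lieDeriv A f) g := by
  have h1 := hasDerivAt_mixed_partial (φ := fun s t => f (g * expSU2 (s • A) * expSU2 (t • B)))
    (φs := fun t => CP1.lieDeriv (adInv (expSU2 (t • B)) A) f (g * expSU2 (t • B)))
    (φt := fun s t => CP1.lieDeriv B f (g * expSU2 (s • A) * expSU2 (t • B)))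
    (ψ := fun s t => CP1.lieDeriv (adInv (expSU2 (t • B)) A) (CP1.lieDeriv B f)
      (g * expSU2 (s • A) * expSU2 (t • B)))
    (fun t => by simpa using hf.hasDerivAt_mul_right A g (expSU2 (t • B)) 0)
    (fun s t => hf.hasDerivAt B _ t)
    (fun s t => (hf.lieDeriv B).hasDerivAt_mul_right A g (expSU2 (t • B)) s) (by
      simp only [(hf.lieDeriv B).lieDeriv_eq_basis (adInv _ A)]
      have hc : ∀ i j, Continuous fun p : ℝ × ℝ => (adInv (expSU2 (p.2 • B)) A).1 i j :=
        fun i j => (continuous_adInv_apply A i j).comp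
          ((continuous_expSU2_smul B).comp continuous_snd)
      have hg : Continuous fun p : ℝ × ℝ => g * expSU2 (p.1 • A) * expSU2 (p.2 • B) :=
        (continuous_const.mul ((continuous_expSU2_smul A).comp continuous_fst)).mul
          ((continuous_expSU2_smul B).comp continuous_snd)
      have he : ∀ e, Continuous fun p : ℝ × ℝ => CP1.lieDeriv e (CP1.lieDeriv B f)
          (g * expSU2 (p.1 • A) * expSU2 (p.2 • B)) :=
        fun e => ((hf.lieDeriv B).lieDeriv e).continuous.comp hg
      exact Continuous.continuousAt ((((continuous_const.mul
        (Complex.continuous_re.comp (hc 0 1))).smul (he e₁)).add ((continuous_const.mul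
        (Complex.continuous_im.comp (hc 0 1))).smul (he e₂))).add ((continuous_const.mul
        (Complex.continuous_im.comp (hc 0 0))).smul (he e₃))))
  have hre : ∀ i j, HasDerivAt (fun t : ℝ => 2 * ((adInv (expSU2 (t • B)) A).1 i j).re)
      (2 * ((⁅A, B⁆ : su2).1 i j).re) 0 := fun i j =>
    (Complex.reCLM.hasFDerivAt.comp_hasDerivAt (0 : ℝ) (hasDerivAt_adInv_apply A B i j)).const_mul 2
  have him : ∀ i j, HasDerivAt (fun t : ℝ => 2 * ((adInv (expSU2 (t • B)) A).1 i j).im)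
      (2 * ((⁅A, B⁆ : su2).1 i j).im) 0 := fun i j =>
    (Complex.imCLM.hasFDerivAt.comp_hasDerivAt (0 : ℝ) (hasDerivAt_adInv_apply A B i j)).const_mul 2
  have he : ∀ e, HasDerivAt (fun t : ℝ => CP1.lieDeriv e f (g * expSU2 (t • B)))
      (CP1.lieDeriv B (CP1.lieDeriv e f) g) 0 := fun e => by
    simpa using! (hf.lieDeriv e).hasDerivAt B g 0
  have h2 := (((hre 0 1).smul (he e₁)).add ((him 0 1).smul (he e₂))).add ((him 0 0).smul (he e₃))
  have h3 : (fun t : ℝ => CP1.lieDeriv (adInv (expSU2 (t • B)) A) f (g * expSU2 (t • B))) = _ :=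
    funext fun t => hf.lieDeriv_eq_basis (adInv (expSU2 (t • B)) A) (g * expSU2 (t • B))
  rw [h3] at h1
  have h4 := h1.unique h2
  -- This identifies the part of `h2` in which the coefficients are frozen at `t = 0` with `B(Af)`.
  have h5 := ((((he e₁).const_smul (2 * (A.1 0 1).re)).add
    ((he e₂).const_smul (2 * (A.1 0 1).im))).add ((he e₃).const_smul (2 * (A.1 0 0).im))).unique
    (((hf.lieDeriv A).hasDerivAt B g 0).congr_of_eventuallyEq
      (Eventually.of_forall fun t => (hf.lieDeriv_eq_basis A (g * expSU2 (t • B))).symm))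
  simp only [zero_smul, expSU2_zero, mul_one, adInv_one] at h4 h5
  rw [h4, hf.lieDeriv_eq_basis, ← h5]
  abel

/-! ### Hermite functions: ladder relations, orthogonality, coefficients -/

theorem contDiff_gaussian : ContDiff ℝ ∞ fun s : ℝ => Real.exp (-s ^ 2) := by fun_prop

theorem hasDerivAt_iteratedDeriv_gaussian (l : ℕ) (x : ℝ) :
    HasDerivAt (iteratedDeriv l fun s : ℝ => Real.exp (-s ^ 2))
      (iteratedDeriv (l + 1) (fun s : ℝ => Real.exp (-s ^ 2)) x) x := by
  rw [iteratedDeriv_succ]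
  refine DifferentiableAt.hasDerivAt ?_
  exact (contDiff_gaussian.differentiable_iteratedDeriv l (by exact_mod_cast ENat.natCast_lt_top l)) x

/-- Differentiate `G' = -2xG` repeatedly. At `l = 0` the truncated index `l - 1` is harmless because
of its factor `l`. -/
theorem iteratedDeriv_gaussian_succ (l : ℕ) (x : ℝ) :
    iteratedDeriv (l + 1) (fun s : ℝ => Real.exp (-s ^ 2)) x =
      -2 * x * iteratedDeriv l (fun s : ℝ => Real.exp (-s ^ 2)) x -
        2 * l * iteratedDeriv (l - 1) (fun s : ℝ => Real.exp (-s ^ 2)) x := by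
  induction l generalizing x with
  | zero =>
    have h : HasDerivAt (fun s : ℝ => Real.exp (-s ^ 2)) (Real.exp (-x ^ 2) * (-(2 * x))) x := by
      simpa using ((hasDerivAt_pow 2 x).neg).exp
    rw [iteratedDeriv_succ, iteratedDeriv_zero, h.deriv]
    push_cast
    ring
  | succ l ih =>
    have h1 := hasDerivAt_iteratedDeriv_gaussian (l + 1) x
    have h2 := ((((hasDerivAt_id x).const_mul (-2)).mul
      (hasDerivAt_iteratedDeriv_gaussian l x)).sub
      ((hasDerivAt_iteratedDeriv_gaussian (l - 1) x).const_mul (2 * (l : ℝ))))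
    have h3 := h1.unique (h2.congr_of_eventuallyEq (Eventually.of_forall ih))
    rw [h3]
    rcases l with _ | l
    · simp; ring
    · simp; ring

theorem hasDerivAt_hermiteFunReal (l : ℕ) (x : ℝ) :
    HasDerivAt (hermiteFunReal l) (x * hermiteFunReal l x + hermiteFunReal (l + 1) x) x := by
  have h1 : HasDerivAt (fun t : ℝ => Real.exp (t ^ 2 / 2)) (Real.exp (x ^ 2 / 2) * x) x := by
    convert! ((hasDerivAt_pow 2 x).div_const 2).exp using 1
    simp
  convert! h1.mul (hasDerivAt_iteratedDeriv_gaussian l x) using 1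
  simp only [hermiteFunReal]
  ring

theorem hermiteFunReal_succ (l : ℕ) (x : ℝ) :
    hermiteFunReal (l + 1) x = -2 * x * hermiteFunReal l x - 2 * l * hermiteFunReal (l - 1) x := by
  simp only [hermiteFunReal, iteratedDeriv_gaussian_succ]
  ring

theorem hermiteFun_eq_ofReal (l : ℕ) (x : ℝ) : hermiteFun l x = (hermiteFunReal l x : ℂ) := rfl

theorem sigmaB_apply (u : 𝓢(ℝ, ℂ)) (x : ℝ) : sigmaB u x = deriv u x := rfl

theorem sigmaB_hermiteFun_apply (l : ℕ) (x : ℝ) :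
    sigmaB (hermiteFun l) x = x * hermiteFun l x + hermiteFun (l + 1) x := by
  have h := (hasDerivAt_hermiteFunReal l x).ofReal_comp
  rw [sigmaB_apply]
  refine Eq.trans (HasDerivAt.deriv h) ?_
  simp [hermiteFun_eq_ofReal]

/-- `b + ia` is `d/dx - x`, which for the chosen sign and normalization raises the index with
coefficient 1; `b - ia = d/dx + x` lowers it. -/
theorem hermiteFun_raise (l : ℕ) :
    sigmaB (hermiteFun l) + I • sigmaA (hermiteFun l) = hermiteFun (l + 1) := by
  ext x
  rw [_root_.add_apply, _root_.smul_apply, sigmaB_hermiteFun_apply, sigmaA_apply,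
    smul_eq_mul]
  linear_combination (x * hermiteFun l x) * I_mul_I

theorem hermiteFun_lower (l : ℕ) :
    sigmaB (hermiteFun l) - I • sigmaA (hermiteFun l) = -(2 * l : ℂ) • hermiteFun (l - 1) := by
  ext x
  have h : hermiteFun (l + 1) x = -2 * x * hermiteFun l x - 2 * l * hermiteFun (l - 1) x := by
    simp only [hermiteFun_eq_ofReal, hermiteFunReal_succ]
    push_cast
    ring
  rw [_root_.sub_apply, _root_.smul_apply, _root_.smul_apply,
    sigmaB_hermiteFun_apply, sigmaA_apply, smul_eq_mul, smul_eq_mul]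
  linear_combination h - (x * hermiteFun l x) * I_mul_I

/-- The canonical commutation relation, the only relation between the two fibre operators that the
Dirac commutators use. -/
theorem sigmaB_sigmaA (u : 𝓢(ℝ, ℂ)) : sigmaB (sigmaA u) = sigmaA (sigmaB u) + I • u := by
  ext x
  have h1 : HasDerivAt (fun y : ℝ => I * (y : ℂ)) I x := by
    simpa using (hasDerivAt_id x).ofReal_comp.const_mul I
  have h2 := h1.mul (u.hasDerivAt x)
  have e : ⇑(sigmaA u) = (fun y : ℝ => I * (y : ℂ)) * ⇑u := funext fun y => sigmaA_apply u y
  rw [_root_.add_apply, _root_.smul_apply, sigmaA_apply, sigmaB_apply, sigmaB_apply, e,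
    h2.deriv, smul_eq_mul]
  ring

/-- The bilinear pairing `∫ u v` of Schwartz functions. -/
def schwartzPairing (u : 𝓢(ℝ, ℂ)) : 𝓢(ℝ, ℂ) →L[ℂ] ℂ :=
  (SchwartzMap.integralCLM ℂ volume).comp (SchwartzMap.pairing (ContinuousLinearMap.mul ℂ ℂ) u)

theorem schwartzPairing_apply (u v : 𝓢(ℝ, ℂ)) : schwartzPairing u v = ∫ x, u x * v x := rfl

theorem schwartzPairing_add (u u' v : 𝓢(ℝ, ℂ)) :
    schwartzPairing (u + u') v = schwartzPairing u v + schwartzPairing u' v := by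
  simp [schwartzPairing]

theorem schwartzPairing_smul (c : ℂ) (u v : 𝓢(ℝ, ℂ)) :
    schwartzPairing (c • u) v = c * schwartzPairing u v := by
  simp [schwartzPairing]

theorem schwartzPairing_sub (u u' v : 𝓢(ℝ, ℂ)) :
    schwartzPairing (u - u') v = schwartzPairing u v - schwartzPairing u' v := by
  simp [schwartzPairing]

theorem schwartzPairing_comm (u v : 𝓢(ℝ, ℂ)) : schwartzPairing u v = schwartzPairing v u := by
  simp only [schwartzPairing_apply, mul_comm]

theorem schwartzPairing_sigmaA (u v : 𝓢(ℝ, ℂ)) :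
    schwartzPairing u (sigmaA v) = schwartzPairing (sigmaA u) v := by
  simp only [schwartzPairing_apply, sigmaA_apply]
  congr 1
  funext x
  ring

theorem schwartzPairing_sigmaB (u v : 𝓢(ℝ, ℂ)) :
    schwartzPairing u (sigmaB v) = -schwartzPairing (sigmaB u) v :=
  SchwartzMap.integral_mul_deriv_eq_neg_deriv_mul u v

/-- The `l`-th Hermite coefficient `∫ h_l u` of `u`. -/
def hermiteCoeff (l : ℕ) : 𝓢(ℝ, ℂ) →L[ℂ] ℂ := schwartzPairing (hermiteFun l)

/-- For the bilinear pairing `a` is symmetric and `b` antisymmetric, so the transpose of `b + ia` is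
`-(b - ia)`, the lowering operator up to sign. -/
theorem hermiteCoeff_lower (l : ℕ) (u : 𝓢(ℝ, ℂ)) :
    hermiteCoeff l (sigmaB u + I • sigmaA u) = 2 * l * hermiteCoeff (l - 1) u := by
  have h : schwartzPairing (hermiteFun l) (sigmaB u + I • sigmaA u) =
      -schwartzPairing (sigmaB (hermiteFun l) - I • sigmaA (hermiteFun l)) u := by
    rw [map_add, map_smul, schwartzPairing_sigmaA, schwartzPairing_sigmaB, schwartzPairing_sub,
      schwartzPairing_smul, smul_eq_mul]
    ring
  rw [hermiteCoeff, h, hermiteFun_lower, schwartzPairing_smul, hermiteCoeff]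
  ring

theorem hermiteCoeff_raise (l : ℕ) (u : 𝓢(ℝ, ℂ)) :
    hermiteCoeff l (sigmaB u - I • sigmaA u) = -hermiteCoeff (l + 1) u := by
  have h : schwartzPairing (hermiteFun l) (sigmaB u - I • sigmaA u) =
      -schwartzPairing (sigmaB (hermiteFun l) + I • sigmaA (hermiteFun l)) u := by
    rw [map_sub, map_smul, schwartzPairing_sigmaA, schwartzPairing_sigmaB, schwartzPairing_add,
      schwartzPairing_smul, smul_eq_mul]
    ring
  rw [hermiteCoeff, h, hermiteFun_raise, hermiteCoeff]

/-- Factorization `H₀ = ((b - ia)(b + ia) + 1) / 2`; the 1 comes from `[b, a] = i`. -/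
theorem oscillator_eq (u : 𝓢(ℝ, ℂ)) : oscillator u =
    (1 / 2 : ℂ) • (sigmaB (sigmaB u + I • sigmaA u) - I • sigmaA (sigmaB u + I • sigmaA u) + u) := by
  simp only [oscillator, _root_.smul_apply, _root_.add_apply,
    ContinuousLinearMap.comp_apply, map_add, map_smul, sigmaB_sigmaA, smul_add, smul_smul, I_mul_I]
  module

theorem hermiteCoeff_oscillator (l : ℕ) (u : 𝓢(ℝ, ℂ)) :
    hermiteCoeff l (oscillator u) = -(l + 1 / 2) * hermiteCoeff l u := by
  rw [oscillator_eq, map_smul, map_add, hermiteCoeff_raise, hermiteCoeff_lower, smul_eq_mul,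
    Nat.add_sub_cancel]
  push_cast
  ring

/-- Stripping one raising operator from `h_k` lowers both indices and gives a factor `2l`; as `l <
k`, the factor `2l = 0` is reached first. -/
theorem hermiteCoeff_hermiteFun_of_lt {l k : ℕ} (h : l < k) :
    hermiteCoeff l (hermiteFun k) = 0 := by
  induction k generalizing l with
  | zero => exact absurd h (Nat.not_lt_zero l)
  | succ k ih =>
    rw [← hermiteFun_raise, hermiteCoeff_lower]
    rcases l with _ | l
    · simp
    · rw [Nat.add_sub_cancel, ih (Nat.lt_of_succ_lt_succ h), mul_zero]

theorem hermiteCoeff_hermiteFun_of_ne {l k : ℕ} (h : l ≠ k) :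
    hermiteCoeff l (hermiteFun k) = 0 := by
  rcases lt_or_gt_of_ne h with h | h
  · exact hermiteCoeff_hermiteFun_of_lt h
  · rw [hermiteCoeff, schwartzPairing_comm]
    exact hermiteCoeff_hermiteFun_of_lt h

/-- Hermite functions are real, so the conjugation in the inner product has no effect. -/
theorem inner_hermiteFun_toLp (l : ℕ) (u : 𝓢(ℝ, ℂ)) :
    inner ℂ ((hermiteFun l).toLp 2 volume) (u.toLp 2 volume) = hermiteCoeff l u := by
  refine (SchwartzMap.inner_toL2_toL2_eq (hermiteFun l) u volume).trans ?_
  refine integral_congr_ae (Eventually.of_forall fun x => ?_)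
  simp [hermiteFun_eq_ofReal, mul_comm]

/-! ### Completeness of the Hermite functions -/

theorem sigmaA_hermiteFun (l : ℕ) : sigmaA (hermiteFun l) =
    (-(I / 2)) • (hermiteFun (l + 1) + (2 * l : ℂ) • hermiteFun (l - 1)) := by
  have h : (2 * I) • sigmaA (hermiteFun l) =
      hermiteFun (l + 1) + (2 * l : ℂ) • hermiteFun (l - 1) := by
    rw [← hermiteFun_raise, ← neg_inj, ← sub_eq_zero]
    have h2 := hermiteFun_lower l
    rw [neg_smul] at h2
    rw [← neg_eq_iff_eq_neg.2 h2]
    module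
  rw [← h, smul_smul, show -(I / 2) * (2 * I) = 1 by linear_combination -I_mul_I, one_smul]

theorem sigmaA_mem_span_hermiteFun {u : 𝓢(ℝ, ℂ)}
    (hu : u ∈ Submodule.span ℂ (Set.range hermiteFun)) :
    sigmaA u ∈ Submodule.span ℂ (Set.range hermiteFun) := by
  induction hu using Submodule.span_induction with
  | mem u hu =>
    obtain ⟨l, rfl⟩ := hu
    rw [sigmaA_hermiteFun]
    exact Submodule.smul_mem _ _ (Submodule.add_mem _ (Submodule.subset_span ⟨_, rfl⟩)
      (Submodule.smul_mem _ _ (Submodule.subset_span ⟨_, rfl⟩)))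
  | zero => simp
  | add u v _ _ hu hv => rw [map_add]; exact Submodule.add_mem _ hu hv
  | smul c u _ hu => rw [map_smul]; exact Submodule.smul_mem _ _ hu

theorem sigmaA_iterate_apply (n : ℕ) (u : 𝓢(ℝ, ℂ)) (x : ℝ) :
    (sigmaA^[n] u) x = (I * x) ^ n * u x := by
  induction n with
  | zero => simp
  | succ n ih => rw [Function.iterate_succ_apply', sigmaA_apply, ih]; ring

/-- The span of the Hermite functions contains the Gaussian `h_0` and is stable under multiplication
by `ix`, so it contains `(ix)ⁿ` times the Gaussian. -/
theorem integral_pow_mul_gaussian_mul_eq_zero {r : Lp ℂ 2 (volume : Measure ℝ)}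
    (hr : ∀ l, inner ℂ ((hermiteFun l).toLp 2 volume) r = 0) (n : ℕ) :
    ∫ x : ℝ, (x : ℂ) ^ n * (Real.exp (-(x ^ 2 / 2)) * r x) = 0 := by
  have h0 : sigmaA^[n] (hermiteFun 0) ∈ Submodule.span ℂ (Set.range hermiteFun) := by
    induction n with
    | zero => exact Submodule.subset_span ⟨0, rfl⟩
    | succ n ih =>
      rw [Function.iterate_succ_apply']
      exact sigmaA_mem_span_hermiteFun ih
  have h1 : ∀ u ∈ Submodule.span ℂ (Set.range hermiteFun),
      inner ℂ (u.toLp 2 volume) r = 0 := by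
    intro u hu
    have e : ∀ u : 𝓢(ℝ, ℂ), u.toLp 2 volume = SchwartzMap.toLpCLM ℂ ℂ 2 volume u := fun _ => rfl
    induction hu using Submodule.span_induction with
    | mem u hu =>
      obtain ⟨l, rfl⟩ := hu
      exact hr l
    | zero => rw [e, map_zero, inner_zero_left]
    | add u v _ _ hu hv =>
      rw [e] at hu hv ⊢
      rw [map_add, inner_add_left, hu, hv, add_zero]
    | smul c u _ hu =>
      rw [e] at hu ⊢
      rw [map_smul, inner_smul_left, hu, mul_zero]
  have h2 := h1 _ h0
  rw [L2.inner_def] at h2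
  have h3 : (∫ x : ℝ, (-I) ^ n * ((x : ℂ) ^ n * (Real.exp (-(x ^ 2 / 2)) * r x))) = 0 := by
    rw [← h2]
    refine integral_congr_ae ?_
    filter_upwards [SchwartzMap.coeFn_toLp (sigmaA^[n] (hermiteFun 0)) 2 volume] with x hx
    have hG : hermiteFun 0 x = (Real.exp (-(x ^ 2 / 2)) : ℂ) := by
      rw [hermiteFun_apply, iteratedDeriv_zero, ← Real.exp_add]
      norm_cast
      congr 1
      ring
    rw [hx, sigmaA_iterate_apply, hG]
    simp only [RCLike.inner_apply, map_mul, map_pow, conj_I, conj_ofReal]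
    ring
  rw [integral_const_mul] at h3
  exact (mul_eq_zero.1 h3).resolve_left (pow_ne_zero _ (neg_ne_zero.2 I_ne_zero))

/-- From `(|c| - |x|/2)² ≥ 0` one gets `|cx| - x²/2 ≤ c² - x²/4`, which leaves a product of two `L²`
functions. -/
theorem integrable_exp_mul_gaussian_mul (r : Lp ℂ 2 (volume : Measure ℝ)) (c : ℝ) :
    Integrable fun x : ℝ => (Real.exp (|c * x|) : ℂ) * ((Real.exp (-(x ^ 2 / 2)) : ℂ) * r x) := by
  have h1 : MemLp (fun x : ℝ => Real.exp (-(1 / 4) * x ^ 2)) 2 volume := by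
    rw [memLp_two_iff_integrable_sq (by fun_prop)]
    refine (integrable_exp_neg_mul_sq (b := 1 / 2) (by norm_num)).congr
      (Eventually.of_forall fun x => ?_)
    simp only [← Real.exp_nat_mul]
    congr 1
    push_cast
    ring
  have h2 := ((h1.integrable_mul (Lp.memLp r).norm).const_mul (Real.exp (c ^ 2)))
  refine Integrable.mono h2 ?_ (Eventually.of_forall fun x => ?_)
  · exact (by fun_prop : Continuous fun x : ℝ => (Real.exp (|c * x|) : ℂ)).aestronglyMeasurable.mul
      ((by fun_prop : Continuous fun x : ℝ =>
        (Real.exp (-(x ^ 2 / 2)) : ℂ)).aestronglyMeasurable.mul (Lp.aestronglyMeasurable r))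
  · simp only [norm_mul, Pi.mul_apply, norm_real, Real.norm_eq_abs, Real.abs_exp, abs_norm]
    rw [← mul_assoc, ← mul_assoc, ← Real.exp_add, ← Real.exp_add]
    refine mul_le_mul_of_nonneg_right (Real.exp_le_exp.2 ?_) (norm_nonneg _)
    rw [abs_mul]
    nlinarith [sq_nonneg (|c| - |x| / 2), sq_abs c, sq_abs x]

/-- Expand the exponential: every term is a vanishing moment, and `exp |cx|` dominates the partial
sums. -/
theorem fourier_gaussian_mul_eq_zero {r : Lp ℂ 2 (volume : Measure ℝ)}
    (hr : ∀ l, inner ℂ ((hermiteFun l).toLp 2 volume) r = 0) (c : ℝ) :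
    ∫ x : ℝ, cexp (c * x * I) * (Real.exp (-(x ^ 2 / 2)) * r x) = 0 := by
  have hm : AEStronglyMeasurable (fun x : ℝ => (Real.exp (-(x ^ 2 / 2)) : ℂ) * r x) volume :=
    (by fun_prop : Continuous fun x : ℝ =>
      (Real.exp (-(x ^ 2 / 2)) : ℂ)).aestronglyMeasurable.mul (Lp.aestronglyMeasurable r)
  have h := hasSum_integral_of_dominated_convergence (μ := volume)
    (F := fun (n : ℕ) (x : ℝ) => (c * x * I) ^ n / (n.factorial : ℂ) *
      ((Real.exp (-(x ^ 2 / 2)) : ℂ) * r x))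
    (f := fun x : ℝ => cexp (c * x * I) * ((Real.exp (-(x ^ 2 / 2)) : ℂ) * r x))
    (fun n x => |c * x| ^ n / (n.factorial : ℝ) * ‖(Real.exp (-(x ^ 2 / 2)) : ℂ) * r x‖)
    (fun n => (by fun_prop : Continuous fun x : ℝ =>
      (c * x * I : ℂ) ^ n / (n.factorial : ℂ)).aestronglyMeasurable.mul hm)
    (fun n => Eventually.of_forall fun x => by
      rw [norm_mul, norm_div, norm_pow, norm_mul, norm_mul, norm_I, mul_one, norm_real, norm_real,
        ← norm_mul, Real.norm_eq_abs, norm_natCast])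
    (Eventually.of_forall fun x => (Real.summable_pow_div_factorial _).mul_right _)
    (by
      refine (integrable_exp_mul_gaussian_mul r c).norm.congr (Eventually.of_forall fun x => ?_)
      simp only
      rw [tsum_mul_right, ← congrFun NormedSpace.exp_eq_tsum_div (|c * x|),
        ← Real.exp_eq_exp_ℝ, norm_mul (Real.exp |c * x| : ℂ), norm_real, Real.norm_eq_abs,
        Real.abs_exp])
    (Eventually.of_forall fun x => by
      refine HasSum.mul_right _ ?_
      rw [Complex.exp_eq_exp_ℂ]
      exact NormedSpace.expSeries_div_hasSum_exp _)
  have h0 : ∀ n : ℕ, (∫ x : ℝ, (c * x * I) ^ n / (n.factorial : ℂ) *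
      ((Real.exp (-(x ^ 2 / 2)) : ℂ) * r x)) = 0 := by
    intro n
    have e : ∀ x : ℝ, (c * x * I) ^ n / (n.factorial : ℂ) *
        ((Real.exp (-(x ^ 2 / 2)) : ℂ) * r x) = ((c * I) ^ n / (n.factorial : ℂ)) *
        ((x : ℂ) ^ n * ((Real.exp (-(x ^ 2 / 2)) : ℂ) * r x)) := fun x => by ring
    simp only [e]
    rw [integral_const_mul, integral_pow_mul_gaussian_mul_eq_zero hr, mul_zero]
  simp only [h0] at h
  exact h.unique hasSum_zero

open scoped FourierTransform RealInnerProductSpace in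
theorem eq_zero_of_inner_hermiteFun_eq_zero {r : Lp ℂ 2 (volume : Measure ℝ)}
    (hr : ∀ l, inner ℂ ((hermiteFun l).toLp 2 volume) r = 0) : r = 0 := by
  set G : ℝ → ℂ := fun x => (Real.exp (-(x ^ 2 / 2)) : ℂ) * r x with hG
  have hGi : Integrable G := by
    simpa [hG] using integrable_exp_mul_gaussian_mul r 0
  have hF : ∀ ξ : ℝ, 𝓕 G ξ = 0 := by
    intro ξ
    rw [Real.fourier_real_eq_integral_exp_smul]
    refine Eq.trans ?_ (fourier_gaussian_mul_eq_zero hr (-2 * Real.pi * ξ))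
    congr 1
    funext x
    rw [smul_eq_mul]
    congr 2
    push_cast
    ring
  have hG0 : ∀ᵐ x : ℝ, G x = 0 := by
    refine ae_eq_zero_of_integral_contDiff_smul_eq_zero hGi.locallyIntegrable fun g hg hgc => ?_
    have hgc' : HasCompactSupport fun x : ℝ => (g x : ℂ) := hgc.comp_left Complex.ofReal_zero
    set ψ : 𝓢(ℝ, ℂ) := hgc'.toSchwartzMap (Complex.ofRealCLM.contDiff.comp hg) with hψ
    -- Every test function is a Fourier transform, and `∫ 𝓕φ · G = ∫ φ · 𝓕G = 0`.
    obtain ⟨φ, hφ⟩ : ∃ φ : 𝓢(ℝ, ℂ), 𝓕 φ = ψ := ⟨𝓕⁻ ψ, FourierTransform.fourier_fourierInv_eq ψ⟩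
    have h := VectorFourier.integral_fourierIntegral_smul_eq_flip (L := innerₗ ℝ)
      Real.continuous_fourierChar continuous_inner (φ.integrable (μ := volume)) hGi
    have h1 : (∫ x : ℝ, (𝓕 φ) x • G x) = ∫ x : ℝ, φ x • 𝓕 G x := by
      rw [flip_innerₗ] at h
      exact h
    rw [hφ] at h1
    simp only [hF, smul_zero, integral_zero] at h1
    rw [← h1]
    rfl
  refine Lp.ext ?_
  filter_upwards [hG0, Lp.coeFn_zero ℂ 2 (volume : Measure ℝ)] with x hx h0
  rw [h0]
  exact (mul_eq_zero.1 hx).resolve_left (by exact_mod_cast (Real.exp_pos _).ne')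

theorem ext_of_hermiteCoeff {u v : 𝓢(ℝ, ℂ)} (h : ∀ l, hermiteCoeff l u = hermiteCoeff l v) :
    u = v := by
  apply SchwartzMap.injective_toLp 2 volume
  rw [← sub_eq_zero]
  refine eq_zero_of_inner_hermiteFun_eq_zero fun l => ?_
  rw [inner_sub_right, inner_hermiteFun_toLp, inner_hermiteFun_toLp, h, sub_self]

/-! ### The metaplectic representation in terms of Hermite coefficients -/

theorem orthogonalFamily_hermiteLine :
    OrthogonalFamily ℂ (fun l => hermiteLine l) fun l => (hermiteLine l).subtypeₗᵢ := by
  intro l k hlk v w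
  obtain ⟨a, ha⟩ := Submodule.mem_span_singleton.1 v.2
  obtain ⟨b, hb⟩ := Submodule.mem_span_singleton.1 w.2
  change inner ℂ (v : Lp ℂ 2 (volume : Measure ℝ)) (w : Lp ℂ 2 (volume : Measure ℝ)) = 0
  rw [← ha, ← hb, inner_smul_left, inner_smul_right, inner_hermiteFun_toLp,
    hermiteCoeff_hermiteFun_of_ne hlk, mul_zero, mul_zero]

/-- Bessel's inequality: the finite projection `w` satisfies `‖w‖² = Re ⟨w, u⟩ ≤ ‖w‖ ‖u‖`. With `|z|
= 1` it makes the series of `metaplectic` converge. -/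
theorem sum_norm_sq_hermiteLine_le (u : Lp ℂ 2 (volume : Measure ℝ)) (s : Finset ℕ) :
    ∑ l ∈ s, ‖(hermiteLine l).orthogonalProjectionOnto u‖ ^ 2 ≤ ‖u‖ ^ 2 := by
  set w := ∑ l ∈ s, (hermiteLine l).starProjection u with hw
  have h1 : ‖w‖ ^ 2 = ∑ l ∈ s, ‖(hermiteLine l).orthogonalProjectionOnto u‖ ^ 2 :=
    orthogonalFamily_hermiteLine.norm_sum
      (fun l => (hermiteLine l).orthogonalProjectionOnto u) s
  have h2 : RCLike.re (inner ℂ w u) =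
      ∑ l ∈ s, ‖(hermiteLine l).orthogonalProjectionOnto u‖ ^ 2 := by
    rw [hw, sum_inner, map_sum]
    exact Finset.sum_congr rfl fun l _ => Submodule.re_inner_starProjection_eq_normSq _ u
  have h3 := re_inner_le_norm (𝕜 := ℂ) w u
  rw [← h1]
  nlinarith [norm_nonneg w, norm_nonneg u, sq_nonneg (‖w‖ - ‖u‖)]

theorem hasSum_metaplectic (z : Circle) (u : Lp ℂ 2 (volume : Measure ℝ)) :
    HasSum (fun l : ℕ => ((z : ℂ) ^ (2 * l + 1)) • (hermiteLine l).starProjection u)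
      (metaplectic z u) := by
  refine Summable.hasSum ((orthogonalFamily_hermiteLine.summable_iff_norm_sq_summable fun l =>
    ((z : ℂ) ^ (2 * l + 1)) • (hermiteLine l).orthogonalProjectionOnto u).2 ?_)
  refine summable_of_sum_le (c := ‖u‖ ^ 2) (fun l => sq_nonneg _) fun s => ?_
  simpa [norm_smul, Circle.norm_coe] using sum_norm_sq_hermiteLine_le u s

theorem inner_hermiteFun_metaplectic (z : Circle) (u : Lp ℂ 2 (volume : Measure ℝ)) (k : ℕ) :
    inner ℂ ((hermiteFun k).toLp 2 volume) (metaplectic z u) =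
      (z : ℂ) ^ (2 * k + 1) * inner ℂ ((hermiteFun k).toLp 2 volume) u := by
  have h := (innerSL ℂ ((hermiteFun k).toLp 2 volume)).hasSum (hasSum_metaplectic z u)
  refine h.unique ?_
  have hk : (hermiteFun k).toLp 2 volume ∈ hermiteLine k := Submodule.mem_span_singleton_self _
  have e : (z : ℂ) ^ (2 * k + 1) * inner ℂ ((hermiteFun k).toLp 2 volume) u =
      innerSL ℂ ((hermiteFun k).toLp 2 volume)
        ((z : ℂ) ^ (2 * k + 1) • (hermiteLine k).starProjection u) := by
    rw [innerSL_apply_apply, inner_smul_right, ← Submodule.inner_starProjection_left_eq_right,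
      Submodule.starProjection_eq_self_iff.2 hk]
  rw [e]
  refine hasSum_single k fun l hl => ?_
  rw [innerSL_apply_apply, inner_smul_right]
  have h0 := orthogonalFamily_hermiteLine hl.symm ⟨_, hk⟩
    ((hermiteLine l).orthogonalProjectionOnto u)
  exact mul_eq_zero_of_right _ h0

theorem toLp_eq_metaplectic_iff (z : Circle) (u v : 𝓢(ℝ, ℂ)) :
    u.toLp 2 volume = metaplectic z (v.toLp 2 volume) ↔
      ∀ l, hermiteCoeff l u = (z : ℂ) ^ (2 * l + 1) * hermiteCoeff l v := by
  constructor
  · intro h l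
    rw [← inner_hermiteFun_toLp, h, inner_hermiteFun_metaplectic, inner_hermiteFun_toLp]
  · intro h
    rw [← sub_eq_zero]
    refine eq_zero_of_inner_hermiteFun_eq_zero fun l => ?_
    rw [inner_sub_right, inner_hermiteFun_metaplectic, inner_hermiteFun_toLp,
      inner_hermiteFun_toLp, h, sub_self]

/-! ### Root frames -/

theorem su2_apply_zero_zero_re (A : su2) : (A.1 0 0).re = 0 := by
  have h := congrArg Complex.re (congrFun (congrFun A.2.1 0) 0)
  simp only [Matrix.conjTranspose_apply, Matrix.neg_apply, Complex.star_def, Complex.conj_re,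
    Complex.neg_re] at h
  linarith

theorem su2_apply_one_zero (A : su2) : A.1 1 0 = -(starRingEnd ℂ) (A.1 0 1) := by
  have h := congrFun (congrFun A.2.1 1) 0
  rw [Matrix.conjTranspose_apply, Matrix.neg_apply] at h
  exact neg_eq_iff_eq_neg.1 h.symm

/-- The coordinates of `A ∈ su(2)` with respect to `e₁`, `e₂`, `e₃`. -/
def su2Equiv : su2 ≃ₗ[ℝ] (Fin 3 → ℝ) where
  toFun A := ![2 * (A.1 0 1).re, 2 * (A.1 0 1).im, 2 * (A.1 0 0).im]
  map_add' A B := by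
    funext i
    fin_cases i <;> simp [mul_add]
  map_smul' c A := by
    funext i
    fin_cases i <;> simp [mul_left_comm]
  invFun x := x 0 • e₁ + x 1 • e₂ + x 2 • e₃
  left_inv A := (su2_eq A).symm
  right_inv x := by
    funext i
    fin_cases i <;> simp [e₁, e₂, e₃] <;> ring

/-- The basis `e₁`, `e₂`, `e₃` of `su(2)`. -/
def su2Basis : Module.Basis (Fin 3) ℝ su2 := Module.Basis.ofEquivFun su2Equiv

/-- Each of `ad e₁`, `ad e₂` is an infinitesimal rotation, whose square has trace `-2`. This fixes
the length of `E`. -/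
theorem killingForm_self (x y : ℝ) :
    killingForm ℝ su2 (x • e₁ + y • e₂) (x • e₁ + y • e₂) = -2 * (x ^ 2 + y ^ 2) := by
  have hb : ∀ i, su2Basis i = ![e₁, e₂, e₃] i := by
    intro i
    rw [su2Basis, Module.Basis.coe_ofEquivFun]
    change (Pi.single i 1 : Fin 3 → ℝ) 0 • e₁ + (Pi.single i 1 : Fin 3 → ℝ) 1 • e₂ +
      (Pi.single i 1 : Fin 3 → ℝ) 2 • e₃ = _
    fin_cases i <;> simp
  have hr : ∀ A i, su2Basis.repr A i = su2Equiv A i := fun A i => by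
    rw [su2Basis, Module.Basis.ofEquivFun_repr_apply]
  have h21 : ⁅e₂, e₁⁆ = -e₃ := by rw [← lie_skew, lie_e₁_e₂]
  have h13 : ⁅e₁, e₃⁆ = -e₂ := by rw [← lie_skew, lie_e₃_e₁]
  rw [killingForm_apply_apply, LinearMap.trace_eq_matrix_trace ℝ su2Basis, Matrix.trace,
    Fin.sum_univ_three]
  simp only [Matrix.diag_apply, LinearMap.toMatrix_apply, hr, hb, LinearMap.comp_apply,
    LieAlgebra.ad_apply, Matrix.cons_val, add_lie, smul_lie, lie_add, lie_smul, lie_self, lie_neg,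
    lie_e₁_e₂, lie_e₂_e₃, h21, h13]
  simp [su2Equiv, e₁, e₂, e₃]
  ring

theorem lie_diag_apply_one_zero (M : Matrix (Fin 2) (Fin 2) ℂ) :
    (⁅(hElt : Matrix (Fin 2) (Fin 2) ℂ), M⁆ : Matrix (Fin 2) (Fin 2) ℂ) 1 0 = -2 * M 1 0 := by
  simp [hElt, LieRing.of_associative_ring_bracket, Matrix.mul_apply, Matrix.vecMul, dotProduct,
    Fin.sum_univ_two]
  ring

theorem lie_diag_apply_zero_zero (M : Matrix (Fin 2) (Fin 2) ℂ) :
    (⁅(hElt : Matrix (Fin 2) (Fin 2) ℂ), M⁆ : Matrix (Fin 2) (Fin 2) ℂ) 0 0 = 0 := by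
  simp [hElt, LieRing.of_associative_ring_bracket, Matrix.mul_apply, Matrix.vecMul, dotProduct,
    Fin.sum_univ_two]

namespace IsRootFrame

variable {E F : su2}

/-- `ad h` acts on the `(1,0)` entry by `-2`, so the eigenvalue 2 makes that entry of `Z` vanish;
conjugation gives the relation at `(0,1)`. -/
theorem apply_zero_one (h : IsRootFrame E F) : F.1 0 1 = I * E.1 0 1 := by
  have h10 := congrFun (congrFun h.root 1) 0
  rw [lie_diag_apply_one_zero] at h10
  simp only [Matrix.smul_apply, Matrix.sub_apply, smul_eq_mul, su2_apply_one_zero] at h10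
  have h1 : (starRingEnd ℂ) (E.1 0 1) = I * (starRingEnd ℂ) (F.1 0 1) := by
    linear_combination (1 / 2) * h10
  have h2 := congrArg (starRingEnd ℂ) h1
  rw [map_mul, Complex.conj_conj, Complex.conj_conj, Complex.conj_I] at h2
  linear_combination -I * h2 + F.1 0 1 * I_mul_I

theorem apply_zero_zero (h : IsRootFrame E F) : E.1 0 0 = 0 ∧ F.1 0 0 = 0 := by
  have h00 := congrFun (congrFun h.root 0) 0
  rw [lie_diag_apply_zero_zero] at h00
  simp only [Matrix.smul_apply, Matrix.sub_apply, smul_eq_mul] at h00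
  have h1 : E.1 0 0 = I * F.1 0 0 := by linear_combination -h00
  have hE := su2_apply_zero_zero_re E
  have hF := su2_apply_zero_zero_re F
  have h2 := congrArg Complex.re h1
  have h3 := congrArg Complex.im h1
  simp only [Complex.mul_re, Complex.mul_im, Complex.I_re, Complex.I_im, hE, hF] at h2 h3
  exact ⟨Complex.ext hE (by rw [h3]; simp), Complex.ext hF (by rw [Complex.zero_im]; linarith)⟩

/-- Root frames differ by a rotation of the plane of `e₁`, `e₂`; the value 1/2 reflects
`-killingForm` being 2 on `e₁` and `e₂`. -/
theorem exists_coords (h : IsRootFrame E F) : ∃ α β : ℝ, α ^ 2 + β ^ 2 = 1 / 2 ∧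
    E = α • e₁ + β • e₂ ∧ F = (-β) • e₁ + α • e₂ := by
  have hE : E = (2 * (E.1 0 1).re) • e₁ + (2 * (E.1 0 1).im) • e₂ := by
    conv_lhs => rw [su2_eq E, h.apply_zero_zero.1]
    simp
  refine ⟨_, _, ?_, hE, ?_⟩
  · have h1 := h.norm_E
    rw [hE, killingForm_self] at h1
    linarith
  · conv_lhs => rw [su2_eq F, h.apply_zero_zero.2, h.apply_zero_one]
    simp

theorem lie_E_F (h : IsRootFrame E F) : ⁅E, F⁆ = (1 / 2 : ℝ) • e₃ := by
  obtain ⟨α, β, hn, rfl, rfl⟩ := h.exists_coords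
  have h21 : ⁅e₂, e₁⁆ = -e₃ := by rw [← lie_skew, lie_e₁_e₂]
  simp only [add_lie, smul_lie, lie_add, lie_smul, lie_self, lie_e₁_e₂, h21, ← hn]
  module

theorem lie_e₃_E (h : IsRootFrame E F) : ⁅e₃, E⁆ = F := by
  obtain ⟨α, β, hn, rfl, rfl⟩ := h.exists_coords
  have h32 : ⁅e₃, e₂⁆ = -e₁ := by rw [← lie_skew, lie_e₂_e₃]
  simp only [lie_add, lie_smul, lie_e₃_e₁, h32]
  module

theorem lie_e₃_F (h : IsRootFrame E F) : ⁅e₃, F⁆ = -E := by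
  obtain ⟨α, β, hn, rfl, rfl⟩ := h.exists_coords
  have h32 : ⁅e₃, e₂⁆ = -e₁ := by rw [← lie_skew, lie_e₂_e₃]
  simp only [lie_add, lie_smul, lie_e₃_e₁, h32]
  module

end IsRootFrame

/-! ### The adjoint action of the torus on a root frame -/

theorem adInv_torus_apply_zero_one (z : Circle) (A : su2) :
    (adInv (torus z) A).1 0 1 = (starRingEnd ℂ) ((z : ℂ) ^ 2) * A.1 0 1 := by
  simp [adInv, torus, Matrix.mul_apply, Fin.sum_univ_two]
  ring

theorem adInv_torus_apply_zero_zero (z : Circle) (A : su2) :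
    (adInv (torus z) A).1 0 0 = A.1 0 0 := by
  have hz : (starRingEnd ℂ) (z : ℂ) * z = 1 := by
    rw [mul_comm, Complex.mul_conj, Circle.normSq_coe, Complex.ofReal_one]
  simp [adInv, torus, Matrix.mul_apply, Fin.sum_univ_two]
  linear_combination A.1 0 0 * hz

theorem su2_ext {A B : su2} (h00 : A.1 0 0 = B.1 0 0) (h01 : A.1 0 1 = B.1 0 1) : A = B := by
  rw [su2_eq A, su2_eq B, h00, h01]

theorem IsRootFrame.adInv_torus_E {E F : su2} (h : IsRootFrame E F) (z : Circle) :
    adInv (torus z) E = ((z : ℂ) ^ 2).re • E - ((z : ℂ) ^ 2).im • F := by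
  apply su2_ext
  · rw [adInv_torus_apply_zero_zero]
    simp [h.apply_zero_zero]
  · rw [adInv_torus_apply_zero_one]
    generalize (z : ℂ) ^ 2 = w
    have hw : (starRingEnd ℂ) w = w.re - w.im * I := Complex.ext (by simp) (by simp)
    simp [h.apply_zero_one, hw]
    ring

theorem IsRootFrame.adInv_torus_F {E F : su2} (h : IsRootFrame E F) (z : Circle) :
    adInv (torus z) F = ((z : ℂ) ^ 2).im • E + ((z : ℂ) ^ 2).re • F := by
  apply su2_ext
  · rw [adInv_torus_apply_zero_zero]
    simp [h.apply_zero_zero]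
  · rw [adInv_torus_apply_zero_one]
    generalize (z : ℂ) ^ 2 = w
    have hw : (starRingEnd ℂ) w = w.re - w.im * I := Complex.ext (by simp) (by simp)
    simp [h.apply_zero_one, hw]
    linear_combination (-(w.im : ℂ) * E.1 0 1) * I_mul_I

/-- The half angle turns the weight `2l + 1` into the oscillator eigenvalue `l + 1/2`. -/
theorem expSU2_smul_e₃ (t : ℝ) : expSU2 (t • e₃) = torus (Circle.exp (t / 2)) := by
  apply Subtype.ext
  have h : ((t • e₃ : su2) : Matrix (Fin 2) (Fin 2) ℂ) =
      Matrix.diagonal ![(t / 2 : ℝ) * I, -((t / 2 : ℝ) * I)] := by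
    ext i j
    fin_cases i <;> fin_cases j <;> simp [e₃] <;> ring
  change NormedSpace.exp ((t • e₃ : su2) : Matrix (Fin 2) (Fin 2) ℂ) = _
  rw [h, Matrix.exp_diagonal]
  ext i j
  fin_cases i <;> fin_cases j <;>
    simp [torus, Pi.coe_exp, ← Complex.exp_eq_exp_ℂ, Circle.coe_exp, ← Complex.exp_conj,
      Complex.conj_ofNat]

/-! ### The complex basis `h`, `X`, `Y` in terms of `e₁`, `e₂`, `e₃` -/

theorem sl2Re_hElt : sl2Re hElt = 0 := by
  apply Subtype.ext
  ext i j
  fin_cases i <;> fin_cases j <;> simp [sl2Re, hElt]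

theorem sl2Im_hElt : sl2Im hElt = (-2 : ℝ) • e₃ := by
  apply Subtype.ext
  ext i j
  fin_cases i <;> fin_cases j <;> simp [sl2Im, hElt, e₃] <;> ring

theorem sl2Re_XElt : sl2Re XElt = e₁ := by
  apply Subtype.ext
  ext i j
  fin_cases i <;> fin_cases j <;> simp [sl2Re, XElt, e₁]
  ring

theorem sl2Im_XElt : sl2Im XElt = (-1 : ℝ) • e₂ := by
  apply Subtype.ext
  ext i j
  fin_cases i <;> fin_cases j <;> simp [sl2Im, XElt, e₂] <;> ring

theorem sl2Re_YElt : sl2Re YElt = (-1 : ℝ) • e₁ := by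
  apply Subtype.ext
  ext i j
  fin_cases i <;> fin_cases j <;> simp [sl2Re, YElt, e₁]
  ring

theorem sl2Im_YElt : sl2Im YElt = (-1 : ℝ) • e₂ := by
  apply Subtype.ext
  ext i j
  fin_cases i <;> fin_cases j <;> simp [sl2Im, YElt, e₂] <;> ring

/-! ### Operator calculus on smooth maps -/

section Module

variable {M : Type*} [AddCommGroup M] [Module ℂ M] {a b e f x : M →ₗ[ℂ] M}

/-- The commutation relations of the creation and annihilation operators `a`, `b` and of the
derivatives `e`, `f`, `x` along a root frame and along `e₃`. -/
structure DiracRelations (a b e f x : M →ₗ[ℂ] M) : Prop where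
  ba : ∀ u, b (a u) = a (b u) + I • u
  ea : ∀ u, e (a u) = a (e u)
  eb : ∀ u, e (b u) = b (e u)
  fa : ∀ u, f (a u) = a (f u)
  fb : ∀ u, f (b u) = b (f u)
  fe : ∀ u, f (e u) = e (f u) - (1 / 2 : ℂ) • x u
  xe : ∀ u, x (e u) = e (x u) + f u
  xf : ∀ u, x (f u) = f (x u) - e u

namespace DiracRelations

/-- In `[D̃, D]` the terms with `a²` and `b²` carry `[E, F] = x/2`, and the mixed terms carry `[b,
a] = i` times `E² + F²`. -/
theorem commutator_apply (h : DiracRelations a b e f x) (u : M) :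
    I • ((a (e (a (f u) - b (e u))) + b (f (a (f u) - b (e u)))) -
      (a (f (a (e u) + b (f u))) - b (e (a (e u) + b (f u))))) =
    I • (1 / 2 : ℂ) • (a (a (x u)) + b (b (x u))) - (e (e u) + f (f u)) := by
  simp only [map_add, map_sub, map_smul, h.ba, h.ea, h.eb, h.fa, h.fb, h.fe, smul_add, smul_sub,
    smul_smul, I_mul_I]
  match_scalars <;> ring_nf

/-- `[H, a] = ib` and `[H, b] = -ia`, so `H` rotates `D` and `D̃` into each other. -/
theorem oscillator_dirac (h : DiracRelations a b e f x) (u : M) :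
    (1 / 2 : ℂ) • (a (a (a (f u) - b (e u))) + b (b (a (f u) - b (e u)))) =
      (1 / 2 : ℂ) • (a (f (a (a u) + b (b u))) - b (e (a (a u) + b (b u)))) +
        I • (a (e u) + b (f u)) := by
  simp only [map_add, map_sub, map_smul, h.ba, h.ea, h.eb, h.fa, h.fb, smul_add, smul_sub,
    smul_smul]
  match_scalars <;> ring_nf

theorem oscillator_dirac' (h : DiracRelations a b e f x) (u : M) :
    (1 / 2 : ℂ) • (a (a (a (e u) + b (f u))) + b (b (a (e u) + b (f u)))) =
      (1 / 2 : ℂ) • (a (e (a (a u) + b (b u))) + b (f (a (a u) + b (b u)))) -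
        I • (a (f u) - b (e u)) := by
  simp only [map_add, map_smul, h.ba, h.ea, h.eb, h.fa, h.fb, smul_add, smul_sub,
    smul_smul]
  match_scalars <;> ring_nf

theorem casimir_comm_e (h : DiracRelations a b e f x) (u : M) :
    e (e (e u)) + f (f (e u)) + (1 / 2 : ℂ) • x (x (e u)) =
      e (e (e u) + f (f u) + (1 / 2 : ℂ) • x (x u)) := by
  simp only [map_add, map_sub, map_smul, h.fe, h.xe, h.xf, smul_add, smul_sub]
  match_scalars <;> ring_nf

theorem casimir_comm_f (h : DiracRelations a b e f x) (u : M) :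
    e (e (f u)) + f (f (f u)) + (1 / 2 : ℂ) • x (x (f u)) =
      f (e (e u) + f (f u) + (1 / 2 : ℂ) • x (x u)) := by
  simp only [map_add, map_sub, map_smul, h.fe, h.xe, h.xf, smul_add, smul_sub]
  match_scalars <;> ring_nf

end DiracRelations

end Module

/-- The space of smooth maps `SU(2) → 𝓢(ℝ)`. -/
def smoothMaps : Submodule ℂ (SU2 → 𝓢(ℝ, ℂ)) where
  carrier := {f | IsSmooth f}
  zero_mem' := isSmooth_zero
  add_mem' := IsSmooth.add
  smul_mem' c _ h :=
    h.clm ((c • ContinuousLinearMap.id ℂ 𝓢(ℝ, ℂ)).restrictScalars ℝ)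

theorem IsSmooth.comp_clm (T : 𝓢(ℝ, ℂ) →L[ℂ] 𝓢(ℝ, ℂ)) {f : SU2 → 𝓢(ℝ, ℂ)} (h : IsSmooth f) :
    IsSmooth fun g => T (f g) :=
  h.clm (T.restrictScalars ℝ)

/-- The derivative along a left-invariant vector field, as an operator on smooth maps. -/
def lieEnd (A : su2) : smoothMaps →ₗ[ℂ] smoothMaps where
  toFun f := ⟨lieDeriv A f, IsSmooth.lieDeriv f.2 A⟩
  map_add' f₁ f₂ := Subtype.ext (IsSmooth.lieDeriv_add f₁.2 f₂.2 A)
  map_smul' c f := Subtype.ext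
    (IsSmooth.lieDeriv_clm ((c • ContinuousLinearMap.id ℂ 𝓢(ℝ, ℂ)).restrictScalars ℝ) f.2 A)

/-- A continuous operator on `𝓢(ℝ)` acting fibrewise, as an operator on smooth maps. -/
def fibreEnd (T : 𝓢(ℝ, ℂ) →L[ℂ] 𝓢(ℝ, ℂ)) : smoothMaps →ₗ[ℂ] smoothMaps where
  toFun f := ⟨fun g => T (f.1 g), IsSmooth.comp_clm T f.2⟩
  map_add' f₁ f₂ := Subtype.ext (funext fun g => map_add T (f₁.1 g) (f₂.1 g))
  map_smul' c f := Subtype.ext (funext fun g => map_smul T c (f.1 g))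

theorem lieEnd_fibreEnd (A : su2) (T : 𝓢(ℝ, ℂ) →L[ℂ] 𝓢(ℝ, ℂ)) (f : smoothMaps) :
    lieEnd A (fibreEnd T f) = fibreEnd T (lieEnd A f) :=
  Subtype.ext (IsSmooth.lieDeriv_clm (T.restrictScalars ℝ) f.2 A)

theorem lieEnd_add (A B : su2) (f : smoothMaps) :
    lieEnd (A + B) f = lieEnd A f + lieEnd B f :=
  Subtype.ext (IsSmooth.lieDeriv_add_left f.2 A B)

theorem lieEnd_smul (c : ℝ) (A : su2) (f : smoothMaps) :
    lieEnd (c • A) f = (c : ℂ) • lieEnd A f := by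
  have hf : IsSmooth f.1 := f.2
  apply Subtype.ext
  funext g
  change lieDeriv (c • A) f.1 g = (c : ℂ) • lieDeriv A f.1 g
  rw [hf.lieDeriv_smul_left, Pi.smul_apply]
  exact (Complex.coe_smul c _).symm

theorem lieEnd_neg (A : su2) (f : smoothMaps) : lieEnd (-A) f = -lieEnd A f := by
  rw [← neg_one_smul ℝ A, lieEnd_smul]
  push_cast
  exact neg_one_smul ℂ (lieEnd A f)

theorem IsSmooth.hermiteCoeff {f : SU2 → 𝓢(ℝ, ℂ)} (h : IsSmooth f) (l : ℕ) :
    IsSmooth fun g => hermiteCoeff l (f g) :=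
  h.clm ((CP1.hermiteCoeff l).restrictScalars ℝ)

theorem IsSmooth.hermiteCoeff_lieDeriv {f : SU2 → 𝓢(ℝ, ℂ)} (h : IsSmooth f) (l : ℕ) (A : su2)
    (g : SU2) : CP1.hermiteCoeff l (CP1.lieDeriv A f g) =
      CP1.lieDeriv A (fun g => CP1.hermiteCoeff l (f g)) g :=
  (congrFun (h.lieDeriv_clm ((CP1.hermiteCoeff l).restrictScalars ℝ) A) g).symm

/-- Hermite coefficients are continuous functionals, so they commute with Lie derivatives, and they
separate points; this reduces to the scalar case. -/
theorem lieEnd_lie (A B : su2) (f : smoothMaps) :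
    lieEnd ⁅A, B⁆ f = lieEnd A (lieEnd B f) - lieEnd B (lieEnd A f) := by
  apply Subtype.ext
  funext g
  refine ext_of_hermiteCoeff fun l => ?_
  have hf : IsSmooth f.1 := f.2
  have e : ∀ A : su2, (fun g => hermiteCoeff l (lieDeriv A f.1 g)) =
      lieDeriv A fun g => hermiteCoeff l (f.1 g) :=
    fun A => funext fun g => hf.hermiteCoeff_lieDeriv l A g
  change hermiteCoeff l (lieDeriv ⁅A, B⁆ f.1 g) =
    hermiteCoeff l (lieDeriv A (lieDeriv B f.1) g - lieDeriv B (lieDeriv A f.1) g)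
  rw [map_sub, hf.hermiteCoeff_lieDeriv, (hf.lieDeriv B).hermiteCoeff_lieDeriv,
    (hf.lieDeriv A).hermiteCoeff_lieDeriv, e, e, (hf.hermiteCoeff l).lieDeriv_lie]

theorem IsRootFrame.diracRelations {E F : su2} (h : IsRootFrame E F) :
    DiracRelations (fibreEnd sigmaA) (fibreEnd sigmaB) (lieEnd E) (lieEnd F) (lieEnd e₃) where
  ba f := Subtype.ext (funext fun g => sigmaB_sigmaA (f.1 g))
  ea f := lieEnd_fibreEnd _ _ f
  eb f := lieEnd_fibreEnd _ _ f
  fa f := lieEnd_fibreEnd _ _ f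
  fb f := lieEnd_fibreEnd _ _ f
  fe f := by
    have h1 := lieEnd_lie E F f
    rw [h.lie_E_F, lieEnd_smul] at h1
    push_cast at h1
    rw [h1]
    abel
  xe f := by
    have h1 := lieEnd_lie e₃ E f
    rw [h.lie_e₃_E] at h1
    rw [h1]
    abel
  xf f := by
    have h1 := lieEnd_lie e₃ F f
    rw [h.lie_e₃_F, lieEnd_neg] at h1
    rw [sub_eq_add_neg, h1]
    abel

/-! ### The operators of the theorem on smooth maps -/

/-- The Dirac operator `D`, as an operator on smooth maps. -/
def diracEnd (E F : su2) : smoothMaps →ₗ[ℂ] smoothMaps :=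
  fibreEnd sigmaA ∘ₗ lieEnd F - fibreEnd sigmaB ∘ₗ lieEnd E

/-- The Dirac operator `D̃`, as an operator on smooth maps. -/
def diracTildeEnd (E F : su2) : smoothMaps →ₗ[ℂ] smoothMaps :=
  fibreEnd sigmaA ∘ₗ lieEnd E + fibreEnd sigmaB ∘ₗ lieEnd F

/-- The operator `P`, as an operator on smooth maps. -/
def commEnd (E F : su2) : smoothMaps →ₗ[ℂ] smoothMaps :=
  I • (diracTildeEnd E F ∘ₗ diracEnd E F - diracEnd E F ∘ₗ diracTildeEnd E F)

/-- The Casimir operator, as an operator on smooth maps, in terms of a root frame. -/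
def casimirEnd (E F : su2) : smoothMaps →ₗ[ℂ] smoothMaps :=
  lieEnd E ∘ₗ lieEnd E + lieEnd F ∘ₗ lieEnd F + (1 / 2 : ℂ) • (lieEnd e₃ ∘ₗ lieEnd e₃)

theorem coe_fibreEnd_oscillator (f : smoothMaps) :
    (fibreEnd oscillator f : SU2 → 𝓢(ℝ, ℂ)) = opH f := rfl

theorem coe_diracEnd (E F : su2) (f : smoothMaps) :
    (diracEnd E F f : SU2 → 𝓢(ℝ, ℂ)) = opD E F f := rfl

theorem coe_diracTildeEnd (E F : su2) (f : smoothMaps) :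
    (diracTildeEnd E F f : SU2 → 𝓢(ℝ, ℂ)) = opDt E F f := rfl

theorem coe_commEnd (E F : su2) (f : smoothMaps) :
    (commEnd E F f : SU2 → 𝓢(ℝ, ℂ)) = opP E F f := rfl

theorem lieDerivC_eq (A : sl2) (f : smoothMaps) : lieDerivC A f =
    ((lieEnd (sl2Re A) f + I • lieEnd (sl2Im A) f : smoothMaps) : SU2 → 𝓢(ℝ, ℂ)) := rfl

/-- With `h = -2i e₃`, `X = e₁ - i e₂`, `Y = -e₁ - i e₂` the Casimir is `(e₁² + e₂² + e₃²)/2`, and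
`α² + β² = 1/2` gives `E² + F² = (e₁² + e₂²)/2`. -/
theorem IsRootFrame.coe_casimirEnd {E F : su2} (h : IsRootFrame E F) (f : smoothMaps) :
    (casimirEnd E F f : SU2 → 𝓢(ℝ, ℂ)) = casimir f := by
  have h0 : casimir (f : SU2 → 𝓢(ℝ, ℂ)) =
      -((1 / 8 : ℂ) • lieDerivC hElt (lieDerivC hElt f)) -
        (1 / 4 : ℂ) • (lieDerivC XElt (lieDerivC YElt f) + lieDerivC YElt (lieDerivC XElt f)) := rfl
  have h1 : casimirEnd E F f = lieEnd E (lieEnd E f) + lieEnd F (lieEnd F f) +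
      (1 / 2 : ℂ) • lieEnd e₃ (lieEnd e₃ f) := rfl
  rw [h0, h1]
  symm
  simp only [lieDerivC_eq, ← Submodule.coe_smul, ← Submodule.coe_neg, ← Submodule.coe_add,
    ← Submodule.coe_sub]
  congr 1
  obtain ⟨α, β, hn, rfl, rfl⟩ := h.exists_coords
  have hn' : (α : ℂ) ^ 2 + (β : ℂ) ^ 2 = 1 / 2 := by
    have h1 := congrArg Complex.ofReal hn
    push_cast at h1
    exact h1
  have hz : ∀ f, lieEnd 0 f = 0 := fun f => by
    rw [← zero_smul ℝ (0 : su2), lieEnd_smul, Complex.ofReal_zero, zero_smul]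
  simp only [sl2Re_hElt, sl2Im_hElt, sl2Re_XElt, sl2Im_XElt, sl2Re_YElt, sl2Im_YElt, hz,
    lieEnd_smul, lieEnd_add, map_add, map_smul, map_zero]
  match_scalars <;> ring_nf
  · linear_combination (-1 / 2 : ℂ) * I_sq
  · linear_combination -hn'
  · linear_combination (-1 / 2 : ℂ) * I_sq - hn'

theorem fibreEnd_oscillator_apply (u : smoothMaps) : fibreEnd oscillator u =
    (1 / 2 : ℂ) • (fibreEnd sigmaA (fibreEnd sigmaA u) + fibreEnd sigmaB (fibreEnd sigmaB u)) := rfl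

namespace IsRootFrame

variable {E F : su2}

theorem commEnd_apply (h : IsRootFrame E F) (u : smoothMaps) : commEnd E F u =
    I • fibreEnd oscillator (lieEnd e₃ u) - (lieEnd E (lieEnd E u) + lieEnd F (lieEnd F u)) :=
  h.diracRelations.commutator_apply u

theorem oscillator_diracEnd (h : IsRootFrame E F) (u : smoothMaps) :
    fibreEnd oscillator (diracEnd E F u) =
      diracEnd E F (fibreEnd oscillator u) + I • diracTildeEnd E F u := by
  refine (h.diracRelations.oscillator_dirac u).trans ?_
  congr 1
  rw [fibreEnd_oscillator_apply, map_smul]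
  rfl

theorem oscillator_diracTildeEnd (h : IsRootFrame E F) (u : smoothMaps) :
    fibreEnd oscillator (diracTildeEnd E F u) =
      diracTildeEnd E F (fibreEnd oscillator u) - I • diracEnd E F u := by
  refine (h.diracRelations.oscillator_dirac' u).trans ?_
  congr 1
  rw [fibreEnd_oscillator_apply, map_smul]
  rfl

theorem casimirEnd_lieEnd_E (h : IsRootFrame E F) (u : smoothMaps) :
    casimirEnd E F (lieEnd E u) = lieEnd E (casimirEnd E F u) :=
  h.diracRelations.casimir_comm_e u

theorem casimirEnd_lieEnd_F (h : IsRootFrame E F) (u : smoothMaps) :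
    casimirEnd E F (lieEnd F u) = lieEnd F (casimirEnd E F u) :=
  h.diracRelations.casimir_comm_f u

end IsRootFrame

theorem casimirEnd_fibreEnd (E F : su2) (T : 𝓢(ℝ, ℂ) →L[ℂ] 𝓢(ℝ, ℂ)) (u : smoothMaps) :
    casimirEnd E F (fibreEnd T u) = fibreEnd T (casimirEnd E F u) := by
  simp only [casimirEnd, LinearMap.add_apply, LinearMap.smul_apply, LinearMap.comp_apply,
    lieEnd_fibreEnd, map_add, map_smul]

theorem IsRootFrame.casimirEnd_diracEnd {E F : su2} (h : IsRootFrame E F) (u : smoothMaps) :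
    casimirEnd E F (diracEnd E F u) = diracEnd E F (casimirEnd E F u) := by
  simp only [diracEnd, LinearMap.sub_apply, LinearMap.comp_apply, map_sub, casimirEnd_fibreEnd,
    h.casimirEnd_lieEnd_E, h.casimirEnd_lieEnd_F]

theorem IsRootFrame.casimirEnd_diracTildeEnd {E F : su2} (h : IsRootFrame E F) (u : smoothMaps) :
    casimirEnd E F (diracTildeEnd E F u) = diracTildeEnd E F (casimirEnd E F u) := by
  simp only [diracTildeEnd, LinearMap.add_apply, LinearMap.comp_apply, map_add,
    casimirEnd_fibreEnd, h.casimirEnd_lieEnd_E, h.casimirEnd_lieEnd_F]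

/-! ### Equivariance -/

theorem mem_spinorSections_iff {f : SU2 → 𝓢(ℝ, ℂ)} : f ∈ spinorSections ↔
    IsSmooth f ∧ ∀ (g : SU2) (z : Circle) (l : ℕ), hermiteCoeff l (f (g * torus z)) =
      ((z⁻¹ : Circle) : ℂ) ^ (2 * l + 1) * hermiteCoeff l (f g) := by
  simp only [spinorSections, Set.mem_ofPred_eq, toLp_eq_metaplectic_iff]

/-- The space of smooth sections of the bundle of metaplectic spinors. -/
def spinorSubmodule : Submodule ℂ (SU2 → 𝓢(ℝ, ℂ)) where
  carrier := spinorSections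
  zero_mem' := mem_spinorSections_iff.2 ⟨smoothMaps.zero_mem, fun g z l => by simp⟩
  add_mem' hf₁ hf₂ := by
    rw [mem_spinorSections_iff] at hf₁ hf₂ ⊢
    refine ⟨smoothMaps.add_mem hf₁.1 hf₂.1, fun g z l => ?_⟩
    rw [Pi.add_apply, Pi.add_apply, map_add, map_add, hf₁.2, hf₂.2, mul_add]
  smul_mem' c f hf := by
    rw [mem_spinorSections_iff] at hf ⊢
    refine ⟨smoothMaps.smul_mem c hf.1, fun g z l => ?_⟩
    rw [Pi.smul_apply, Pi.smul_apply, map_smul, map_smul, hf.2, smul_eq_mul, smul_eq_mul,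
      mul_left_comm]

theorem opH_mem {f : SU2 → 𝓢(ℝ, ℂ)} (hf : f ∈ spinorSubmodule) : opH f ∈ spinorSubmodule := by
  have hf' := mem_spinorSections_iff.1 hf
  refine mem_spinorSections_iff.2 ⟨(fibreEnd oscillator ⟨f, hf'.1⟩).2, fun g z l => ?_⟩
  rw [opH, opH, hermiteCoeff_oscillator, hermiteCoeff_oscillator, hf'.2, mul_left_comm]

/-- On sections, the derivative along `e₃ ∈ 𝔱` is `i H`. -/
theorem lieDeriv_e₃_eq {f : SU2 → 𝓢(ℝ, ℂ)} (hf : f ∈ spinorSubmodule) :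
    lieDeriv e₃ f = I • opH f := by
  have hf' := mem_spinorSections_iff.1 hf
  funext g
  refine ext_of_hermiteCoeff fun l => ?_
  rw [hf'.1.hermiteCoeff_lieDeriv, Pi.smul_apply, map_smul, opH, hermiteCoeff_oscillator,
    smul_eq_mul]
  have h1 := (hf'.1.hermiteCoeff l).hasDerivAt e₃ g 0
  simp only [expSU2_smul_e₃, hf'.2] at h1
  have h2 : HasDerivAt (fun t : ℝ => cexp (-(2 * l + 1) / 2 * I * t))
      (-(2 * l + 1) / 2 * I) 0 := by
    simpa using ((Complex.ofRealCLM.hasDerivAt (x := (0 : ℝ))).const_mul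
      (-(2 * l + 1) / 2 * I : ℂ)).cexp
  have h3 : ∀ t : ℝ, (((Circle.exp (t / 2))⁻¹ : Circle) : ℂ) ^ (2 * l + 1) =
      cexp (-(2 * l + 1) / 2 * I * t) := by
    intro t
    rw [← Circle.exp_neg, Circle.coe_exp, ← Complex.exp_nat_mul]
    congr 1
    push_cast
    ring
  simp only [h3] at h1
  have h4 := h1.unique (h2.mul_const (hermiteCoeff l (f g)))
  rw [zero_div, Circle.exp_zero] at h4
  have h5 : torus 1 = 1 := by
    apply Subtype.ext
    ext i j
    fin_cases i <;> fin_cases j <;> simp [torus]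
  rw [h5, mul_one] at h4
  rw [h4]
  ring

/-- Differentiate the equivariance of `f` along `g exp(sA)`, moving the torus element past the
exponential. -/
theorem lieDeriv_adInv_torus {f : SU2 → 𝓢(ℝ, ℂ)} (hf : f ∈ spinorSubmodule) (A : su2) (g : SU2)
    (z : Circle) (l : ℕ) :
    hermiteCoeff l (lieDeriv (adInv (torus z) A) f (g * torus z)) =
      ((z⁻¹ : Circle) : ℂ) ^ (2 * l + 1) * hermiteCoeff l (lieDeriv A f g) := by
  have hf' := mem_spinorSections_iff.1 hf
  rw [hf'.1.hermiteCoeff_lieDeriv, hf'.1.hermiteCoeff_lieDeriv]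
  have h1 := (hf'.1.hermiteCoeff l).hasDerivAt_mul_right A g (torus z) 0
  have h2 := ((hf'.1.hermiteCoeff l).hasDerivAt A g 0).const_mul
    (((z⁻¹ : Circle) : ℂ) ^ (2 * l + 1))
  simp only [hf'.2, zero_smul, expSU2_zero, mul_one] at h1 h2
  exact h1.unique h2

theorem circle_sq_re_im (z : Circle) :
    ((z : ℂ) ^ 2 = ((z : ℂ) ^ 2).re + ((z : ℂ) ^ 2).im * I) ∧
      (((z⁻¹ : Circle) : ℂ) ^ 2 = ((z : ℂ) ^ 2).re - ((z : ℂ) ^ 2).im * I) := by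
  refine ⟨(Complex.re_add_im _).symm, ?_⟩
  rw [Circle.coe_inv_eq_conj, ← map_pow]
  generalize (z : ℂ) ^ 2 = w
  exact Complex.ext (by simp) (by simp)

theorem circle_mul_inv (z : Circle) : (z : ℂ) * ((z⁻¹ : Circle) : ℂ) = 1 := by
  rw [← Circle.coe_mul, mul_inv_cancel, Circle.coe_one]

namespace IsRootFrame

variable {E F : su2} {f : SU2 → 𝓢(ℝ, ℂ)}

theorem hermiteCoeff_lieDeriv_torus (h : IsRootFrame E F) (hf : f ∈ spinorSubmodule) (g : SU2)
    (z : Circle) (l : ℕ) :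
    ((z : ℂ) ^ 2).re * hermiteCoeff l (lieDeriv E f (g * torus z)) -
        ((z : ℂ) ^ 2).im * hermiteCoeff l (lieDeriv F f (g * torus z)) =
      ((z⁻¹ : Circle) : ℂ) ^ (2 * l + 1) * hermiteCoeff l (lieDeriv E f g) ∧
    ((z : ℂ) ^ 2).im * hermiteCoeff l (lieDeriv E f (g * torus z)) +
        ((z : ℂ) ^ 2).re * hermiteCoeff l (lieDeriv F f (g * torus z)) =
      ((z⁻¹ : Circle) : ℂ) ^ (2 * l + 1) * hermiteCoeff l (lieDeriv F f g) := by
  have hs := (mem_spinorSections_iff.1 hf).1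
  have e : ∀ (c : ℝ) (u : 𝓢(ℝ, ℂ)), hermiteCoeff l (c • u) = c * hermiteCoeff l u := fun c u => by
    rw [← Complex.coe_smul, map_smul, smul_eq_mul]
  rw [← lieDeriv_adInv_torus hf, ← lieDeriv_adInv_torus hf, h.adInv_torus_E, h.adInv_torus_F,
    sub_eq_add_neg (_ • E), ← neg_smul, hs.lieDeriv_add_left, hs.lieDeriv_add_left]
  simp only [hs.lieDeriv_smul_left, Pi.add_apply, Pi.smul_apply, map_add, e]
  push_cast
  exact ⟨by ring, trivial⟩

/-- `E - iF` is an eigenvector of the torus: the inverse adjoint action multiplies it by the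
conjugate of `z²`. -/
theorem hermiteCoeff_rootDeriv (h : IsRootFrame E F) (hf : f ∈ spinorSubmodule) (g : SU2)
    (z : Circle) (l : ℕ) :
    hermiteCoeff l (lieDeriv E f (g * torus z) - I • lieDeriv F f (g * torus z)) =
      (z : ℂ) ^ 2 * ((z⁻¹ : Circle) : ℂ) ^ (2 * l + 1) *
        hermiteCoeff l (lieDeriv E f g - I • lieDeriv F f g) := by
  obtain ⟨h1, h2⟩ := h.hermiteCoeff_lieDeriv_torus hf g z l
  obtain ⟨-, h4⟩ := circle_sq_re_im z
  have h5 := circle_mul_inv z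
  rw [map_sub, map_smul, smul_eq_mul, map_sub, map_smul, smul_eq_mul, mul_assoc, mul_sub,
    mul_left_comm _ I, ← h1, ← h2]
  have h6 : (z : ℂ) ^ 2 * ((z⁻¹ : Circle) : ℂ) ^ 2 = 1 := by rw [← mul_pow, h5, one_pow]
  rw [h4] at h6
  linear_combination -(hermiteCoeff l (lieDeriv E f (g * torus z)) -
    I * hermiteCoeff l (lieDeriv F f (g * torus z))) * h6 +
    (z : ℂ) ^ 2 * ((z : ℂ) ^ 2).im * hermiteCoeff l (lieDeriv F f (g * torus z)) * I_mul_I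

theorem hermiteCoeff_rootDeriv' (h : IsRootFrame E F) (hf : f ∈ spinorSubmodule) (g : SU2)
    (z : Circle) (l : ℕ) :
    hermiteCoeff l (lieDeriv E f (g * torus z) + I • lieDeriv F f (g * torus z)) =
      ((z⁻¹ : Circle) : ℂ) ^ 2 * ((z⁻¹ : Circle) : ℂ) ^ (2 * l + 1) *
        hermiteCoeff l (lieDeriv E f g + I • lieDeriv F f g) := by
  obtain ⟨h1, h2⟩ := h.hermiteCoeff_lieDeriv_torus hf g z l
  obtain ⟨h3, -⟩ := circle_sq_re_im z
  have h5 := circle_mul_inv z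
  rw [map_add, map_smul, smul_eq_mul, map_add, map_smul, smul_eq_mul, mul_assoc, mul_add,
    mul_left_comm _ I, ← h1, ← h2]
  have h6 : (z : ℂ) ^ 2 * ((z⁻¹ : Circle) : ℂ) ^ 2 = 1 := by rw [← mul_pow, h5, one_pow]
  linear_combination -(hermiteCoeff l (lieDeriv E f (g * torus z)) +
    I * hermiteCoeff l (lieDeriv F f (g * torus z))) * h6 +
    (hermiteCoeff l (lieDeriv E f (g * torus z)) +
    I * hermiteCoeff l (lieDeriv F f (g * torus z))) * ((z⁻¹ : Circle) : ℂ) ^ 2 * h3 +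
    ((z⁻¹ : Circle) : ℂ) ^ 2 * ((z : ℂ) ^ 2).im *
    hermiteCoeff l (lieDeriv F f (g * torus z)) * I_mul_I

/-- The factorization pairs one ladder operator with one root vector, so the action on torus weights
can be read off. -/
theorem dolb_apply (E F : su2) (f : SU2 → 𝓢(ℝ, ℂ)) (g : SU2) : dolb E F f g =
    -(sigmaB (lieDeriv E f g - I • lieDeriv F f g) -
      I • sigmaA (lieDeriv E f g - I • lieDeriv F f g)) := by
  simp only [dolb, opD, opDt, Pi.add_apply, Pi.smul_apply, map_sub, map_smul]
  match_scalars <;> ring_nf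
  simp

theorem dolbBar_apply (E F : su2) (f : SU2 → 𝓢(ℝ, ℂ)) (g : SU2) : dolbBar E F f g =
    -(sigmaB (lieDeriv E f g + I • lieDeriv F f g) +
      I • sigmaA (lieDeriv E f g + I • lieDeriv F f g)) := by
  simp only [dolbBar, opD, opDt, Pi.sub_apply, Pi.smul_apply, map_add, map_smul]
  match_scalars <;> ring_nf
  simp

/-- Coefficient `l` of `𝒟f` is coefficient `l + 1` of `(E - iF)f`, of weight `2 - (2l + 3) = -(2l +
1)`. -/
theorem dolb_mem (h : IsRootFrame E F) (hf : f ∈ spinorSubmodule) :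
    dolb E F f ∈ spinorSubmodule := by
  have hf' := mem_spinorSections_iff.1 hf
  refine mem_spinorSections_iff.2 ⟨(diracEnd E F ⟨f, hf'.1⟩ + I • diracTildeEnd E F ⟨f, hf'.1⟩).2,
    fun g z l => ?_⟩
  rw [dolb_apply, dolb_apply, map_neg, map_neg, hermiteCoeff_raise, hermiteCoeff_raise,
    h.hermiteCoeff_rootDeriv hf]
  have h5 := circle_mul_inv z
  have h6 : (z : ℂ) ^ 2 * ((z⁻¹ : Circle) : ℂ) ^ 2 = 1 := by rw [← mul_pow, h5, one_pow]
  rw [show 2 * (l + 1) + 1 = 2 + (2 * l + 1) by ring, pow_add, ← mul_assoc, h6]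
  ring

theorem dolbBar_mem (h : IsRootFrame E F) (hf : f ∈ spinorSubmodule) :
    dolbBar E F f ∈ spinorSubmodule := by
  have hf' := mem_spinorSections_iff.1 hf
  refine mem_spinorSections_iff.2 ⟨(diracEnd E F ⟨f, hf'.1⟩ - I • diracTildeEnd E F ⟨f, hf'.1⟩).2,
    fun g z l => ?_⟩
  rw [dolbBar_apply, dolbBar_apply, map_neg, map_neg, hermiteCoeff_lower, hermiteCoeff_lower]
  -- At `l = 0` the index `l - 1` is truncated, but the factor `2l` kills both sides.
  rcases l with _ | l
  · simp
  · rw [h.hermiteCoeff_rootDeriv' hf, Nat.add_sub_cancel]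
    ring

theorem opD_mem (h : IsRootFrame E F) (hf : f ∈ spinorSubmodule) :
    opD E F f ∈ spinorSubmodule := by
  have e : opD E F f = (1 / 2 : ℂ) • (dolb E F f + dolbBar E F f) := by
    rw [dolb, dolbBar]
    module
  rw [e]
  exact Submodule.smul_mem _ _ (Submodule.add_mem _ (h.dolb_mem hf) (h.dolbBar_mem hf))

theorem opDt_mem (h : IsRootFrame E F) (hf : f ∈ spinorSubmodule) :
    opDt E F f ∈ spinorSubmodule := by
  have e : opDt E F f = (-I / 2 : ℂ) • (dolb E F f - dolbBar E F f) := by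
    rw [dolb, dolbBar]
    match_scalars <;> ring_nf
    simp
  rw [e]
  exact Submodule.smul_mem _ _ (Submodule.sub_mem _ (h.dolb_mem hf) (h.dolbBar_mem hf))

theorem opP_mem (h : IsRootFrame E F) (hf : f ∈ spinorSubmodule) :
    opP E F f ∈ spinorSubmodule :=
  Submodule.smul_mem _ _ (Submodule.sub_mem _ (h.opDt_mem (h.opD_mem hf))
    (h.opD_mem (h.opDt_mem hf)))

/-! ### The operator `P` on sections -/

/-- Since `e₃` commutes with `H`, `e₃ = iH` on sections gives `e₃² = -H²`. So `iHe₃` contributes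
`-H²`, and `e₃²/2` in the Casimir a further `-H²/2`. -/
theorem commEnd_eq (h : IsRootFrame E F) {u : smoothMaps}
    (hu : (u : SU2 → 𝓢(ℝ, ℂ)) ∈ spinorSubmodule) : commEnd E F u =
      -casimirEnd E F u - (3 / 2 : ℂ) • fibreEnd oscillator (fibreEnd oscillator u) := by
  have h1 : lieEnd e₃ u = I • fibreEnd oscillator u := Subtype.ext (lieDeriv_e₃_eq hu)
  have h2 : casimirEnd E F u = lieEnd E (lieEnd E u) + lieEnd F (lieEnd F u) +
      (1 / 2 : ℂ) • lieEnd e₃ (lieEnd e₃ u) := rfl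
  rw [h.commEnd_apply, h2, h1, map_smul, map_smul, lieEnd_fibreEnd, h1, map_smul]
  match_scalars <;> ring_nf
  simp
  norm_num

/-- The formula for `P` is applied to `u` and to `𝒟u`, the latter being a section by `dolb_mem`;
what remains is `-(3/2)[H², 𝒟]`. -/
theorem commEnd_dolb (h : IsRootFrame E F) {u : smoothMaps}
    (hu : (u : SU2 → 𝓢(ℝ, ℂ)) ∈ spinorSubmodule) :
    commEnd E F (diracEnd E F u + I • diracTildeEnd E F u) -
        (diracEnd E F (commEnd E F u) + I • diracTildeEnd E F (commEnd E F u)) =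
      -((3 : ℂ) • (diracEnd E F (fibreEnd oscillator u) +
          I • diracTildeEnd E F (fibreEnd oscillator u))) -
        (3 / 2 : ℂ) • (diracEnd E F u + I • diracTildeEnd E F u) := by
  rw [h.commEnd_eq hu, h.commEnd_eq (u := diracEnd E F u + I • diracTildeEnd E F u)
    (h.dolb_mem hu)]
  simp only [map_add, map_sub, map_neg, map_smul, h.casimirEnd_diracEnd,
    h.casimirEnd_diracTildeEnd, h.oscillator_diracEnd, h.oscillator_diracTildeEnd]
  match_scalars <;> ring_nf <;> simp <;> norm_num

theorem commEnd_dolbBar (h : IsRootFrame E F) {u : smoothMaps}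
    (hu : (u : SU2 → 𝓢(ℝ, ℂ)) ∈ spinorSubmodule) :
    commEnd E F (diracEnd E F u - I • diracTildeEnd E F u) -
        (diracEnd E F (commEnd E F u) - I • diracTildeEnd E F (commEnd E F u)) =
      (3 : ℂ) • (diracEnd E F (fibreEnd oscillator u) -
          I • diracTildeEnd E F (fibreEnd oscillator u)) -
        (3 / 2 : ℂ) • (diracEnd E F u - I • diracTildeEnd E F u) := by
  rw [h.commEnd_eq hu, h.commEnd_eq (u := diracEnd E F u - I • diracTildeEnd E F u)
    (h.dolbBar_mem hu)]
  simp only [map_add, map_sub, map_neg, map_smul, h.casimirEnd_diracEnd,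
    h.casimirEnd_diracTildeEnd, h.oscillator_diracEnd, h.oscillator_diracTildeEnd]
  match_scalars <;> ring_nf <;> simp <;> norm_num

theorem opP_eq (h : IsRootFrame E F) (hf : f ∈ spinorSubmodule) :
    opP E F f = -casimir f - (3 / 2 : ℂ) • opH (opH f) := by
  have hu := congrArg Subtype.val (h.commEnd_eq (u := ⟨f, (mem_spinorSections_iff.1 hf).1⟩) hf)
  rw [coe_commEnd] at hu
  rw [hu, ← h.coe_casimirEnd ⟨f, (mem_spinorSections_iff.1 hf).1⟩]
  rfl

theorem opP_dolb (h : IsRootFrame E F) (hf : f ∈ spinorSubmodule) :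
    opP E F (dolb E F f) - dolb E F (opP E F f) =
      -((3 : ℂ) • dolb E F (opH f)) - (3 / 2 : ℂ) • dolb E F f := by
  have H := congrArg Subtype.val
    (h.commEnd_dolb (u := ⟨f, (mem_spinorSections_iff.1 hf).1⟩) hf)
  simpa only [Submodule.coe_sub, Submodule.coe_add, Submodule.coe_neg, Submodule.coe_smul,
    coe_commEnd, dolb, coe_diracEnd, coe_diracTildeEnd, coe_fibreEnd_oscillator] using H

theorem opP_dolbBar (h : IsRootFrame E F) (hf : f ∈ spinorSubmodule) :
    opP E F (dolbBar E F f) - dolbBar E F (opP E F f) =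
      (3 : ℂ) • dolbBar E F (opH f) - (3 / 2 : ℂ) • dolbBar E F f := by
  have H := congrArg Subtype.val
    (h.commEnd_dolbBar (u := ⟨f, (mem_spinorSections_iff.1 hf).1⟩) hf)
  simpa only [Submodule.coe_sub, Submodule.coe_add, Submodule.coe_neg, Submodule.coe_smul,
    coe_commEnd, dolbBar, coe_diracEnd, coe_diracTildeEnd, coe_fibreEnd_oscillator] using H

/-- Solving the formula for `P` for the Casimir term avoids a separate equivariance check. -/
theorem casimir_mem (h : IsRootFrame E F) (hf : f ∈ spinorSubmodule) :
    casimir f ∈ spinorSubmodule := by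
  have e : casimir f = -opP E F f - (3 / 2 : ℂ) • opH (opH f) := by
    rw [h.opP_eq hf]
    module
  rw [e]
  exact Submodule.sub_mem _ (Submodule.neg_mem _ (h.opP_mem hf))
    (Submodule.smul_mem _ _ (opH_mem (opH_mem hf)))

end IsRootFrame

end CP1

end

theorem mainTheorem9 (E F : CP1.su2) (hEF : CP1.IsRootFrame E F) :
    (Set.MapsTo CP1.opH CP1.spinorSections CP1.spinorSections ∧
      Set.MapsTo (CP1.opD E F) CP1.spinorSections CP1.spinorSections ∧
      Set.MapsTo (CP1.opDt E F) CP1.spinorSections CP1.spinorSections ∧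
      Set.MapsTo CP1.casimir CP1.spinorSections CP1.spinorSections) ∧
    ∀ f ∈ CP1.spinorSections,
      CP1.opP E F f = -CP1.casimir f - (3 / 2 : ℂ) • CP1.opH (CP1.opH f) ∧
      CP1.opP E F (CP1.dolb E F f) - CP1.dolb E F (CP1.opP E F f) =
        -((3 : ℂ) • CP1.dolb E F (CP1.opH f)) - (3 / 2 : ℂ) • CP1.dolb E F f ∧
      CP1.opP E F (CP1.dolbBar E F f) - CP1.dolbBar E F (CP1.opP E F f) =
        (3 : ℂ) • CP1.dolbBar E F (CP1.opH f) - (3 / 2 : ℂ) • CP1.dolbBar E F f := by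

  refine ⟨⟨fun f hf => CP1.opH_mem hf, fun f hf => hEF.opD_mem hf, fun f hf => hEF.opDt_mem hf,
    fun f hf => hEF.casimir_mem hf⟩, fun f hf => ⟨hEF.opP_eq hf, hEF.opP_dolb hf, hEF.opP_dolbBar hf⟩⟩
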